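/- Finite binary strings are the elements of $\{0,1\}^*$, $|p|$ is the length of $p$. A computer is a partial recursive function $C:\{0,1\}^*\to\{0,1\}^*$ whose domain $\mathrm{Dom}\,C$ is prefix-free (no element is a prefix of another one). A computer $U$ is optimal if for each computer $C$ there is a constant $\mathrm{sim}(C)$ such that whenever $C(p)$ is defined there is $p'$ with $U(p')=C(p)$ and $|p'|\le|p|+\mathrm{sim}(C)$. Let $U$ be any optimal computer and let $H(s)=\min\{|p| : U(p)=s\}$. A real $T$ is computable if there is a total recursive $f:\mathbb N^+\to\mathbb Q$ with $|T-f(n)|<1/n$ for all $n\in\mathbb N^+$. It is right-computable if there is a total recursive $g:\mathbb N^+\to\mathbb Q$ with $T\le g(n)$ for all $n\in\mathbb N^+$ and $\lim_{n\to\infty} g(n)=T$, and left-computable if $-T$ is right-computable. For a real $T$, let $T_n$ denote the string of the first $n$ bits of the base-two expansion of $T-\lfloor T\rfloor$ with infinitely many zeros. For $D\ge 0$, the real $T$ is Chaitin $D$-random if $\lim_{n\to\infty}\bigl(H(T_n)-Dn\bigr)=\infty$, and $D$-compressible if $H(T_n)\le Dn+o(n)$. For real numbers $Q,D>0$ let $$W(Q,D)=\sum_{p\in\mathrm{Dom}\,U}|p|^{Q}\,2^{-|p|/D}.$$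 Theorem. Let $Q$ and $D$ be positive real numbers. (i) If $Q$ and $D$ are computable and $D<1$, then $W(Q,D)$ converges to a left-computable real number which is Chaitin $D$-random and $D$-compressible. (ii) If $D\ge 1$, then $W(Q,D)$ diverges to $\infty$. -/

import Mathlib

open Filter Topology Asymptotics

namespace AIT

/-! ### Computable sequences of rationals and effectively approximable reals -/

/-- `f : ℕ → ℚ` is a total recursive sequence of rationals: it is presented as
`f n = (a n - b n) / (c n + 1)` with total recursive `a b c : ℕ → ℕ`. -/
def RecursiveRat (f : ℕ → ℚ) : Prop :=
  ∃ a b c : ℕ → ℕ, Computable a ∧ Computable b ∧ Computable c ∧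
    ∀ n, f n = ((a n : ℚ) - (b n : ℚ)) / ((c n : ℚ) + 1)

/-- `T` is computable: some total recursive `f` satisfies `|T - f n| < 1 / n` for all
positive integers `n`. (The value at `n = 0` is unconstrained.) -/
def ComputableReal (T : ℝ) : Prop :=
  ∃ f : ℕ → ℚ, RecursiveRat f ∧ ∀ n : ℕ, 0 < n → |T - (f n : ℝ)| < 1 / (n : ℝ)

/-- `T` is right-computable: it is the limit of a total recursive sequence of rationals
bounded below by `T`. -/
def RightComputable (T : ℝ) : Prop :=
  ∃ g : ℕ → ℚ, RecursiveRat g ∧ (∀ n : ℕ, 0 < n → T ≤ (g n : ℝ)) ∧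
    Tendsto (fun n : ℕ => (g n : ℝ)) atTop (𝓝 T)

/-- `T` is left-computable: `-T` is right-computable. -/
def LeftComputable (T : ℝ) : Prop :=
  RightComputable (-T)

/-! ### Computers and program-size complexity

Finite binary strings are `List Bool`, partial functions are `· →. ·`, and partial
recursiveness is Mathlib's `Partrec`. -/

/-- A computer: a partial recursive function from strings to strings whose domain of
definition is prefix-free. -/
def IsComputer (C : List Bool →. List Bool) : Prop :=
  Partrec C ∧ ∀ p q : List Bool, (C p).Dom → (C q).Dom → p <+: q → p = q

/-- An optimal computer: it simulates every computer `C` with programs that are longer by at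
most a constant `sim` depending only on `C`. -/
def IsOptimal (U : List Bool →. List Bool) : Prop :=
  IsComputer U ∧ ∀ C : List Bool →. List Bool, IsComputer C →
    ∃ sim : ℕ, ∀ p s : List Bool, s ∈ C p →
      ∃ p' : List Bool, s ∈ U p' ∧ p'.length ≤ p.length + sim

/-- Program-size complexity `H_C(s)`, the minimal length of a `p` with `C(p) = s`. For an
optimal computer the set is nonempty for every `s`: see `IsOptimal.exists_program`. -/
noncomputable def H (C : List Bool →. List Bool) (s : List Bool) : ℕ :=
  sInf {l : ℕ | ∃ p : List Bool, p.length = l ∧ s ∈ C p}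

/-- Under an optimal computer every string has a program. -/
theorem IsOptimal.exists_program {U : List Bool →. List Bool} (hU : IsOptimal U)
    (s : List Bool) : ∃ p : List Bool, s ∈ U p := by
  let C : List Bool →. List Bool := fun p =>
    ((if p.length = 0 then some s else none : Option (List Bool)) : Part (List Bool))
  have hdom : ∀ p, (C p).Dom → p = [] := by
    intro p hp
    by_contra hne
    simp [C] at hp
    exact hne hp
  have hpr : Primrec (fun p : List Bool =>
      (if p.length = 0 then some s else none : Option (List Bool))) :=
    Primrec.ite (Primrec.eq.comp Primrec.list_length (Primrec.const 0))
      (Primrec.const _) (Primrec.const _)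
  have hC : IsComputer C :=
    ⟨hpr.to_comp.ofOption, fun p q hp hq _ => (hdom p hp).trans (hdom q hq).symm⟩
  obtain ⟨_, h⟩ := hU.2 C hC
  obtain ⟨p', hp', _⟩ := h [] s (by simp [C])
  exact ⟨p', hp'⟩

/-! ### Randomness notions for infinite binary strings -/

/-- The prefix of length `n` of an infinite binary string. -/
def pre (α : ℕ → Bool) (n : ℕ) : List Bool :=
  (List.range n).map α

/-- The infinite binary string `α` such that `0.α` is the base-two expansion of `T mod 1`
with infinitely many zeros (`Real.digits x 2 i` is the parity of `⌊x * 2 ^ (i + 1)⌋`). -/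
noncomputable def bits (T : ℝ) (i : ℕ) : Bool :=
  decide (Real.digits (Int.fract T) 2 i = 1)

/-- `α` is Chaitin `D`-random (relative to `U`): `H(α_n) - D n → ∞`. -/
def ChaitinRandom (U : List Bool →. List Bool) (D : ℝ) (α : ℕ → Bool) : Prop :=
  Tendsto (fun n : ℕ => (H U (pre α n) : ℝ) - D * (n : ℝ)) atTop atTop

/-- `α` is `D`-compressible (relative to `U`): `H(α_n) ≤ D n + o(n)`. -/
def Compressible (U : List Bool →. List Bool) (D : ℝ) (α : ℕ → Bool) : Prop :=
  ∃ f : ℕ → ℝ, f =o[atTop] (fun n : ℕ => (n : ℝ)) ∧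
    ∀ n : ℕ, 0 < n → (H U (pre α n) : ℝ) ≤ D * (n : ℝ) + f n

/-! ### The series `W(Q, D)` -/

/-- The domain of definition of `U`. -/
abbrev Dom (U : List Bool →. List Bool) : Type :=
  {p : List Bool // (U p).Dom}

/-- The term `|p| ^ Q * 2 ^ (-|p| / D)`. -/
noncomputable def term (Q D : ℝ) (p : List Bool) : ℝ :=
  (p.length : ℝ) ^ Q * (2 : ℝ) ^ (-(p.length : ℝ) / D)

/-- The value of the series of `term Q D p` over `p ∈ Dom U` (meaningful if it converges). -/
noncomputable def W (U : List Bool →. List Bool) (Q D : ℝ) : ℝ :=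
  ∑' p : Dom U, term Q D p.1

end AIT

namespace AIT

/-! ### Prefix-free sets and the Kraft inequality -/

/-! Convergence for `D < 1`: the weights are `O(2 ^ (-ℓ))`, so the Kraft inequality bounds all
finite sums. A repetition-free enumeration of the graph of `U`, with computable weights summed with
downward rounding (`LowerApprox`), gives left-computability.

Randomness: the first `n` bits of `W` lead to a stage `k` whose lower approximation is within `3 / 2
^ n` of `W`. A string longer than all outputs seen before `k` has only programs that appear later,
so a shortest one, of length `h`, has weight at most `3 / 2 ^ n`. Taking logarithms, `h - D * n` is
at least a positive multiple of `Q * log h` minus a constant; the factor `|p| ^ Q` is what makes it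
diverge. The string is computed from the bits, so the bits have at least this complexity up to a
constant.

Compressibility: for rational `r` with `D < r < 1`, the `r`-th powers of the terms form the
convergent series `W(Q r, D / r)`. Hence the integer part of `2 ^ n` times the lower approximation
changes only `O(2 ^ (r n))` times (`exists_numChanges_le`). The number of changes and a bounded
correction determine the bits, at a cost of `r n + O(√n)`; then `r` approaches `D`.

Divergence for `D ≥ 1`: `n` in self-delimiting form followed by any string of length `g n + 2`
yields `2 ^ (g n + 2)` distinct programs of nearly that length. By Kraft at least half have length
above `g n`, and `(g n) ^ Q` outweighs the cost of encoding `n` once `g` grows fast enough. -/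

/-- The two first words are prefixes of one string, hence comparable, hence equal, and can be
cancelled. This is the unique decodability required by Kraft–McMillan. -/
theorem eq_of_flatten_eq_of_prefix_free {S : Set (List Bool)}
    (hS : ∀ p ∈ S, ∀ q ∈ S, p <+: q → p = q) (h0 : [] ∉ S) :
    ∀ L₁ L₂ : List (List Bool), (∀ w ∈ L₁, w ∈ S) → (∀ w ∈ L₂, w ∈ S) →
      L₁.flatten = L₂.flatten → L₁ = L₂
  | [], [], _, _, _ => rfl
  | [], q :: L₂, _, h₂, h => by
    have hq : q = [] := by
      have : [] = q ++ L₂.flatten := by simpa using h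
      exact (List.append_eq_nil_iff.1 this.symm).1
    exact absurd (hq ▸ h₂ q (by simp)) h0
  | p :: L₁, [], h₁, _, h => by
    have hp : p = [] := by
      have : p ++ L₁.flatten = [] := by simpa using h
      exact (List.append_eq_nil_iff.1 this).1
    exact absurd (hp ▸ h₁ p (by simp)) h0
  | p :: L₁, q :: L₂, h₁, h₂, h => by
    have h' : p ++ L₁.flatten = q ++ L₂.flatten := by simpa using h
    have hpq : p = q := by
      have hp := h₁ p (by simp)
      have hq := h₂ q (by simp)
      have e1 : p <+: q ++ L₂.flatten := ⟨_, h'⟩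
      rcases List.prefix_or_prefix_of_prefix e1 (List.prefix_append q L₂.flatten) with h3 | h3
      · exact hS p hp q hq h3
      · exact (hS q hq p hp h3).symm
    subst hpq
    have := eq_of_flatten_eq_of_prefix_free hS h0 L₁ L₂
      (fun w hw => h₁ w (by simp [hw])) (fun w hw => h₂ w (by simp [hw]))
      (List.append_cancel_left h')
    rw [this]

theorem sum_half_pow_length_le_one {S : Finset (List Bool)}
    (hS : ∀ p ∈ S, ∀ q ∈ S, p <+: q → p = q) :
    ∑ p ∈ S, (1 / 2 : ℝ) ^ p.length ≤ 1 := by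
  -- `{[]}` is prefix-free but not uniquely decodable, so it is treated directly.
  by_cases h0 : [] ∈ S
  · have : S = {[]} := by
      ext q
      simp only [Finset.mem_singleton]
      exact ⟨fun hq => (hS [] h0 q hq List.nil_prefix).symm, fun hq => hq ▸ h0⟩
    simp [this]
  · have := InformationTheory.kraft_mcmillan_inequality (S := S)
      (fun L₁ L₂ h₁ h₂ h => eq_of_flatten_eq_of_prefix_free (S := (S : Set (List Bool)))
        (by simpa using hS) (by simpa using h0) L₁ L₂ h₁ h₂ h)
    simpa using this

/-! ### Binary numerals of a fixed length -/

/-- The `n` low-order binary digits of `v`, most significant first. -/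
def toBinary (n v : ℕ) : List Bool :=
  (List.range n).map fun i => decide (v / 2 ^ (n - 1 - i) % 2 = 1)

/-- The number with the given binary digits, most significant first. -/
def ofBinary (s : List Bool) : ℕ :=
  s.foldl (fun v b => 2 * v + b.toNat) 0

@[simp] theorem length_toBinary (n v : ℕ) : (toBinary n v).length = n := by
  simp [toBinary]

theorem toBinary_succ (n v : ℕ) :
    toBinary (n + 1) v = toBinary n (v / 2) ++ [decide (v % 2 = 1)] := by
  simp only [toBinary, List.range_succ, List.map_append, List.map_cons, List.map_nil]
  congr 1
  · refine List.map_congr_left fun i hi => ?_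
    have hi : i < n := by simpa using hi
    rw [Nat.div_div_eq_div_mul, ← pow_succ', show n + 1 - 1 - i = n - 1 - i + 1 by omega]
  · simp

theorem ofBinary_concat (s : List Bool) (b : Bool) :
    ofBinary (s ++ [b]) = 2 * ofBinary s + b.toNat := by
  simp [ofBinary]

theorem ofBinary_toBinary (n v : ℕ) : ofBinary (toBinary n v) = v % 2 ^ n := by
  induction n generalizing v with
  | zero => simp [toBinary, ofBinary, Nat.mod_one]
  | succ n ih =>
    rw [toBinary_succ, ofBinary_concat, ih, pow_succ', Nat.mod_mul]
    rcases Nat.mod_two_eq_zero_or_one v with h | h <;> (simp [h]; try omega)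

theorem toBinary_injOn (n : ℕ) : Set.InjOn (toBinary n) (Set.Iio (2 ^ n)) := by
  intro v hv w hw h
  have := congrArg ofBinary h
  rwa [ofBinary_toBinary, ofBinary_toBinary, Nat.mod_eq_of_lt hv, Nat.mod_eq_of_lt hw] at this

/-- Dividing `⌊2 ^ n * T⌋₊` by a power of two gives `⌊2 ^ (i + 1) * T⌋₊`, whose parity is unaffected
by removing the integer part of `T`. -/
theorem pre_bits {T : ℝ} (hT : 0 ≤ T) (n : ℕ) :
    pre (bits T) n = toBinary n ⌊2 ^ n * T⌋₊ := by
  refine List.map_congr_left fun i hi => ?_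
  have hi : i < n := by simpa using hi
  have h1 : ⌊2 ^ n * T⌋₊ / 2 ^ (n - 1 - i) = ⌊2 ^ (i + 1) * T⌋₊ := by
    rw [← Nat.floor_div_natCast]
    congr 1
    have : (2 : ℝ) ^ n = 2 ^ (i + 1) * 2 ^ (n - 1 - i) := by
      rw [← pow_add]; congr 1; omega
    rw [this]
    push_cast
    field_simp
  have h2 : ⌊2 ^ (i + 1) * T⌋₊ % 2 = ⌊Int.fract T * 2 ^ (i + 1)⌋₊ % 2 := by
    have h3 : 2 ^ (i + 1) * T = Int.fract T * 2 ^ (i + 1) + ((⌊T⌋₊ * 2 ^ (i + 1) : ℕ) : ℝ) := by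
      have := Int.self_sub_floor T
      have h4 : ((⌊T⌋₊ : ℕ) : ℝ) = (⌊T⌋ : ℝ) := by
        exact natCast_floor_eq_intCast_floor hT
      push_cast
      rw [← this, h4]; ring
    rw [h3, Nat.floor_add_natCast (by have := Int.fract_nonneg T; positivity), Nat.add_mod,
      (show ⌊T⌋₊ * 2 ^ (i + 1) % 2 = 0 by simp [pow_succ, ← mul_assoc]), Nat.add_zero, Nat.mod_mod]
  rw [h1, h2]
  unfold bits Real.digits
  simp [Fin.ext_iff]

theorem primrec_pow : Primrec₂ ((· ^ ·) : ℕ → ℕ → ℕ) :=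
  Primrec₂.unpaired'.1 Nat.Primrec.pow

theorem primrec_toBinary : Primrec₂ toBinary := by
  refine Primrec.list_map (Primrec.list_range.comp Primrec.fst) ?_
  refine PrimrecRel.decide (R := fun (a : ℕ × ℕ) (i : ℕ) => a.2 / 2 ^ (a.1 - 1 - i) % 2 = 1) ?_
  refine PrimrecRel.comp Primrec.eq ?_ (Primrec.const 1)
  refine Primrec.nat_mod.comp (Primrec.nat_div.comp (Primrec.snd.comp Primrec.fst) ?_)
    (Primrec.const 2)
  exact primrec_pow.comp (Primrec.const 2) (Primrec.nat_sub.comp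
    (Primrec.nat_sub.comp (Primrec.fst.comp Primrec.fst) (Primrec.const 1)) Primrec.snd)

theorem primrec_ofBinary : Primrec ofBinary := by
  refine Primrec.list_foldl (h := fun _ (a : ℕ × Bool) => 2 * a.1 + a.2.toNat)
    Primrec.id (Primrec.const 0) ?_
  exact Primrec.nat_add.comp
    (Primrec.nat_mul.comp (Primrec.const 2) (Primrec.fst.comp Primrec.snd))
    ((Primrec.dom_bool Bool.toNat).comp (Primrec.snd.comp Primrec.snd))

/-! ### A prefix code for the natural numbers -/

/-- A self-delimiting code of the natural number `n` of length `O(√n)`. -/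
def header (n : ℕ) : List Bool :=
  List.replicate n.unpair.1 true ++ false :: (List.replicate n.unpair.2 true ++ [false])

/-- Both components of `n.unpair` are at most `n.sqrt`. The sublinear length is absorbed by the
`o(n)` in compressibility. -/
theorem length_header_le (n : ℕ) : (header n).length ≤ 2 * n.sqrt + 2 := by
  have h := Nat.sqrt_le_add n
  simp only [header, List.length_append, List.length_replicate, List.length_cons, List.length_nil]
  simp only [Nat.unpair]
  split_ifs with h1 <;> omega

/-- The first `false` marks the end of the unary block, whatever follows. -/
theorem unary_prefix {a b : ℕ} {s t : List Bool}
    (h : List.replicate a true ++ false :: s <+: List.replicate b true ++ false :: t) :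
    a = b ∧ s <+: t := by
  induction a generalizing b with
  | zero =>
    cases b with
    | zero => exact ⟨rfl, by simpa using h⟩
    | succ b => simp [List.replicate_succ] at h
  | succ a ih =>
    cases b with
    | zero => simp [List.replicate_succ] at h
    | succ b =>
      have := ih (b := b) (by simpa [List.replicate_succ] using h)
      exact ⟨by omega, this.2⟩

theorem header_append_prefix {n m : ℕ} {s t : List Bool}
    (h : header n ++ s <+: header m ++ t) : n = m ∧ s <+: t := by
  simp only [header, List.append_assoc, List.cons_append, List.nil_append] at h
  obtain ⟨h1, h⟩ := unary_prefix h
  obtain ⟨h2, h⟩ := unary_prefix h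
  exact ⟨by rw [← Nat.pair_unpair n, h1, h2, Nat.pair_unpair], h⟩

theorem primrec_replicate_true : Primrec fun n : ℕ => List.replicate n true := by
  refine (Primrec.list_map Primrec.list_range (g := fun _ _ => true) (Primrec.const true)).of_eq
    fun n => ?_
  simp

theorem primrec_header : Primrec header := by
  refine Primrec.list_append.comp
    (primrec_replicate_true.comp (Primrec.fst.comp Primrec.unpair)) ?_
  refine Primrec.list_cons.comp (Primrec.const false) ?_
  exact Primrec.list_append.comp
    (primrec_replicate_true.comp (Primrec.snd.comp Primrec.unpair)) (Primrec.const [false])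

theorem computable_decide_eq {α β : Type*} [Primcodable α] [Primcodable β] [DecidableEq β]
    {f g : α → β} (hf : Computable f) (hg : Computable g) :
    Computable fun a => decide (f a = g a) :=
  (PrimrecRel.decide (Primrec.eq (α := β))).to_comp.comp hf hg

/-! ### Programs for an optimal computer -/

theorem H_le {U : List Bool →. List Bool} {p s : List Bool} (h : s ∈ U p) : H U s ≤ p.length :=
  Nat.sInf_le ⟨p, rfl, h⟩

theorem IsOptimal.exists_program_length_eq {U : List Bool →. List Bool} (hU : IsOptimal U)
    (s : List Bool) : ∃ p, s ∈ U p ∧ p.length = H U s := by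
  obtain ⟨p₀, hp₀⟩ := hU.exists_program s
  have hmem : H U s ∈ {l : ℕ | ∃ p : List Bool, p.length = l ∧ s ∈ U p} :=
    Nat.sInf_mem ⟨_, p₀, rfl, hp₀⟩
  obtain ⟨p, hpl, hp⟩ := hmem
  exact ⟨p, hp, hpl⟩

/-- Composing an optimal computer with a partial recursive function. -/
theorem IsOptimal.exists_program_map {U : List Bool →. List Bool} (hU : IsOptimal U)
    {F : List Bool →. List Bool} (hF : Partrec F) :
    ∃ c : ℕ, ∀ s x, x ∈ F s → H U x ≤ H U s + c := by
  have hC : IsComputer fun p => (U p).bind F := by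
    refine ⟨hU.1.1.bind (hF.comp Computable.snd).to₂, fun p q hp hq h => ?_⟩
    exact hU.1.2 p q (Part.bind_dom.1 hp).1 (Part.bind_dom.1 hq).1 h
  obtain ⟨c, hc⟩ := hU.2 _ hC
  refine ⟨c, fun s x hx => ?_⟩
  obtain ⟨p, hp, hpl⟩ := hU.exists_program_length_eq s
  obtain ⟨p', hp', hl⟩ := hc p x (Part.mem_bind hp hx)
  exact (H_le hp').trans (hpl ▸ hl)

/-- Coding by a self-delimiting number `n` followed by a string of length `ℓ n`. -/
theorem IsOptimal.exists_program_block {U : List Bool →. List Bool} (hU : IsOptimal U)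
    {ℓ : ℕ → ℕ} (hℓ : Computable ℓ) {F : ℕ × List Bool →. List Bool} (hF : Partrec F) :
    ∃ c : ℕ, ∀ n s x, s.length = ℓ n → x ∈ F (n, s) →
      ∃ p, x ∈ U p ∧ p.length ≤ (header n).length + ℓ n + c := by
  -- Parsing is by search: the pair coded by `k` is accepted if it reassembles to `p` and its block
  -- has the prescribed length.
  let parse : List Bool → ℕ → Option (ℕ × List Bool) := fun p k =>
    (Encodable.decode k : Option (ℕ × List Bool)).bind fun a =>
      cond (decide (p = header a.1 ++ a.2) && decide (a.2.length = ℓ a.1)) (some a) none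
  have hparse_some : ∀ p k a, a ∈ parse p k → p = header a.1 ++ a.2 ∧ a.2.length = ℓ a.1 := by
    intro p k a h
    simp only [parse, Option.mem_def, Option.bind_eq_some_iff] at h
    obtain ⟨b, _, h⟩ := h
    cases hb : decide (p = header b.1 ++ b.2) && decide (b.2.length = ℓ b.1) with
    | false => simp [hb] at h
    | true =>
      simp only [hb, cond_true, Option.some.injEq] at h
      subst h
      simpa using hb
  have hcomp : Computable₂ parse := by
    refine Computable.option_bind (Computable.decode.comp Computable.snd) ?_
    refine Computable.cond ?_ (Computable.option_some.comp Computable.snd) (Computable.const none)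
    refine Primrec.and.to_comp.comp ?_ ?_
    · refine computable_decide_eq (Computable.fst.comp Computable.fst) ?_
      exact Computable.list_append.comp
        (primrec_header.to_comp.comp (Computable.fst.comp Computable.snd))
        (Computable.snd.comp Computable.snd)
    · exact computable_decide_eq (Computable.list_length.comp (Computable.snd.comp Computable.snd))
        (hℓ.comp (Computable.fst.comp Computable.snd))
  let C : List Bool →. List Bool := fun p => (Nat.rfindOpt (parse p)).bind F
  have hdom : ∀ p, (C p).Dom → ∃ n s, p = header n ++ s ∧ s.length = ℓ n := by
    intro p hp
    obtain ⟨h, _⟩ := Part.bind_dom.1 hp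
    obtain ⟨k, hk⟩ := Nat.rfindOpt_spec (Part.get_mem h)
    exact ⟨_, _, hparse_some p k _ hk⟩
  have hC : IsComputer C := by
    refine ⟨(Partrec.rfindOpt hcomp).bind (hF.comp Computable.snd).to₂, fun p q hp hq h => ?_⟩
    obtain ⟨n, s, rfl, hs⟩ := hdom p hp
    obtain ⟨m, t, rfl, ht⟩ := hdom q hq
    -- Equal headers force blocks of equal length, so a prefix relation between them is an equality.
    obtain ⟨rfl, hst⟩ := header_append_prefix h
    rw [hst.eq_of_length (hs.trans ht.symm)]
  obtain ⟨c, hc⟩ := hU.2 C hC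
  refine ⟨c, fun n s x hs hx => ?_⟩
  have hmem : (n, s) ∈ Nat.rfindOpt (parse (header n ++ s)) := by
    have hd : (Nat.rfindOpt (parse (header n ++ s))).Dom := by
      refine Nat.rfindOpt_dom.2 ⟨Encodable.encode (n, s), (n, s), ?_⟩
      simp [parse, hs]
    obtain ⟨⟨m, t⟩, ha⟩ := Part.dom_iff_mem.1 hd
    obtain ⟨k, hk⟩ := Nat.rfindOpt_spec ha
    obtain ⟨h1, h2⟩ := hparse_some _ _ _ hk
    obtain ⟨rfl, h4⟩ := header_append_prefix (show header n ++ s <+: header m ++ t by rw [h1])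
    cases h4.eq_of_length (hs.trans h2.symm)
    exact ha
  obtain ⟨p, hp, hl⟩ := hc _ x (Part.mem_bind hmem hx)
  refine ⟨p, hp, hl.trans ?_⟩
  simp [hs]

/-- A repetition-free computable enumeration of the graph of a partial recursive function. -/
theorem exists_enumeration {U : List Bool →. List Bool} (hU : Partrec U) :
    ∃ e : ℕ → Option (List Bool × List Bool), Computable e ∧
      (∀ m p s, e m = some (p, s) → s ∈ U p) ∧
      (∀ p s, s ∈ U p → ∃ m, e m = some (p, s)) ∧
      (∀ m m' p s s', e m = some (p, s) → e m' = some (p, s') → m = m') := by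
  obtain ⟨c, hc⟩ := Nat.Partrec.Code.exists_code.1 hU
  let ev : ℕ → ℕ → Option ℕ := fun k i => Nat.Partrec.Code.evaln k c i
  have hev : Primrec₂ ev := Nat.Partrec.Code.primrec_evaln.comp
    (Primrec.pair (Primrec.pair Primrec.fst (Primrec.const c)) Primrec.snd)
  have hmem : ∀ p x, x ∈ Nat.Partrec.Code.eval c (Encodable.encode p) ↔
      ∃ s ∈ U p, Encodable.encode s = x := by
    intro p x
    rw [hc]
    simp
  -- Here `m` codes a bound and an input. A pair is emitted only when the computation fails within
  -- the bound but succeeds within the next one; by monotonicity of `evaln` this happens once per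
  -- program. `decode₂` rejects numbers that are not codes of strings.
  let e : ℕ → Option (List Bool × List Bool) := fun m =>
    cond (ev m.unpair.1 m.unpair.2).isSome none
      ((Encodable.decode₂ (List Bool) m.unpair.2).bind fun p =>
        (ev (m.unpair.1 + 1) m.unpair.2).bind fun x =>
          (Encodable.decode x : Option (List Bool)).map fun s => (p, s))
  have he : ∀ m p s, e m = some (p, s) ↔ ev m.unpair.1 m.unpair.2 = none ∧
      Encodable.encode p = m.unpair.2 ∧ ∃ x, ev (m.unpair.1 + 1) m.unpair.2 = some x ∧
        Encodable.decode x = some s := by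
    intro m p s
    simp only [e, ← Encodable.decode₂_eq_some]
    cases h : ev m.unpair.1 m.unpair.2 with
    | none => simp [Option.bind_eq_some_iff]
    | some y => simp
  refine ⟨e, ?_, ?_, ?_, ?_⟩
  · refine Primrec.to_comp ?_
    have h1 : Primrec fun m : ℕ => m.unpair.1 := Primrec.fst.comp Primrec.unpair
    have h2 : Primrec fun m : ℕ => m.unpair.2 := Primrec.snd.comp Primrec.unpair
    refine Primrec.cond (Primrec.option_isSome.comp (hev.comp h1 h2)) (Primrec.const none) ?_
    refine Primrec.option_bind (Primrec.decode₂.comp h2) ?_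
    refine Primrec.option_bind (hev.comp (Primrec.succ.comp (h1.comp Primrec.fst))
      (h2.comp Primrec.fst)) ?_
    refine Primrec.option_map (Primrec.decode.comp Primrec.snd) ?_
    exact Primrec.pair (Primrec.snd.comp (Primrec.fst.comp Primrec.fst)) Primrec.snd
  · intro m p s h
    obtain ⟨_, h2, x, h3, h4⟩ := (he m p s).1 h
    rw [← h2] at h3
    obtain ⟨s', hs', rfl⟩ := (hmem _ _).1 (Nat.Partrec.Code.evaln_sound h3)
    rw [Encodable.encodek, Option.some.injEq] at h4
    exact h4 ▸ hs'
  · intro p s h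
    have hex : ∃ k, ev k (Encodable.encode p) ≠ none := by
      obtain ⟨k, hk⟩ := Nat.Partrec.Code.evaln_complete.1 ((hmem p _).2 ⟨s, h, rfl⟩)
      exact ⟨k, by simp only [ev]; rw [Option.mem_def.1 hk]; simp⟩
    classical
    have h1 := Nat.find_spec hex
    have h0 : Nat.find hex ≠ 0 := fun h => by
      rw [h] at h1
      simp [ev, Nat.Partrec.Code.evaln] at h1
    obtain ⟨k, hk⟩ := Nat.exists_eq_succ_of_ne_zero h0
    have h2 := not_not.1 (Nat.find_min hex (m := k) (by omega))
    rw [hk] at h1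
    obtain ⟨x, hx⟩ := Option.ne_none_iff_exists'.1 h1
    refine ⟨Nat.pair k (Encodable.encode p), (he _ _ _).2 ?_⟩
    rw [Nat.unpair_pair]
    refine ⟨h2, rfl, x, hx, ?_⟩
    obtain ⟨s', hs', rfl⟩ := (hmem _ _).1 (Nat.Partrec.Code.evaln_sound hx)
    rw [Encodable.encodek, Part.mem_unique hs' h]
  · intro m m' p s s' h h'
    obtain ⟨h1, h2, x, h3, -⟩ := (he m p s).1 h
    obtain ⟨h1', h2', x', h3', -⟩ := (he m' p s').1 h'
    have key : ∀ k l i x, ev k i = none → ev (l + 1) i = some x → k ≤ l := by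
      intro k l i x hk hl
      by_contra hlt
      have := Nat.Partrec.Code.evaln_mono (show l + 1 ≤ k by omega) hl
      exact Option.some_ne_none x (this.symm.trans hk)
    rw [← h2] at h1 h3
    rw [← h2'] at h1' h3'
    have := key _ _ _ _ h1 h3'
    have := key _ _ _ _ h1' h3
    rw [← Nat.pair_unpair m, ← Nat.pair_unpair m', ← h2, ← h2']
    congr 1
    omega

/-! ### The weights `ℓ ^ Q * 2 ^ (-ℓ / D)` -/

/-- The common value of `term Q D p` for the strings `p` of length `ℓ`. -/
noncomputable def weight (Q D : ℝ) (ℓ : ℕ) : ℝ :=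
  (ℓ : ℝ) ^ Q * (2 : ℝ) ^ (-(ℓ : ℝ) / D)

theorem term_eq_weight (Q D : ℝ) (p : List Bool) : term Q D p = weight Q D p.length := rfl

theorem weight_nonneg (Q D : ℝ) (ℓ : ℕ) : 0 ≤ weight Q D ℓ := by
  unfold weight; positivity

theorem term_nonneg (Q D : ℝ) (p : List Bool) : 0 ≤ term Q D p :=
  weight_nonneg Q D p.length

/-- For `D < r` the new parameter `D / r` is below `1`, so the `r`-th powers of the terms are
summable as well. -/
theorem weight_rpow (Q D r : ℝ) (ℓ : ℕ) : weight Q D ℓ ^ r = weight (Q * r) (D / r) ℓ := by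
  unfold weight
  rw [Real.mul_rpow (by positivity) (by positivity), ← Real.rpow_mul (by positivity),
    ← Real.rpow_mul (by positivity)]
  congr 2
  rw [div_div_eq_mul_div, div_mul_eq_mul_div]

/-- After `2 ^ (-ℓ)` is split off, an exponential decay of rate `(1 / D - 1) * log 2 > 0` remains,
which beats `ℓ ^ Q`. -/
theorem exists_weight_le (Q : ℝ) {D : ℝ} (hD : 0 < D) (hD1 : D < 1) :
    ∃ C : ℝ, 0 ≤ C ∧ ∀ ℓ, weight Q D ℓ ≤ C * (1 / 2) ^ ℓ := by
  have hb : 0 < (1 / D - 1) * Real.log 2 :=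
    mul_pos (by rw [sub_pos, lt_div_iff₀ hD]; linarith) (Real.log_pos one_lt_two)
  have h := ((tendsto_rpow_mul_exp_neg_mul_atTop_nhds_zero Q _ hb).comp
    tendsto_natCast_atTop_atTop).bddAbove_range
  obtain ⟨C, hC⟩ := h
  have hC : ∀ ℓ : ℕ, (ℓ : ℝ) ^ Q * Real.exp (-((1 / D - 1) * Real.log 2) * ℓ) ≤ C :=
    fun ℓ => hC ⟨ℓ, rfl⟩
  refine ⟨C, le_trans (by positivity) (hC 1), fun ℓ => ?_⟩
  refine le_trans (le_of_eq ?_) (mul_le_mul_of_nonneg_right (hC ℓ) (by positivity))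
  unfold weight
  rw [mul_assoc]
  congr 1
  rw [Real.rpow_def_of_pos two_pos, one_div_pow, one_div ((2 : ℝ) ^ ℓ), ← Real.rpow_natCast,
    Real.rpow_def_of_pos two_pos, ← Real.exp_neg, ← Real.exp_add]
  congr 1
  ring

theorem exists_sum_weight_le (Q : ℝ) {D : ℝ} (hD : 0 < D) (hD1 : D < 1) :
    ∃ C : ℝ, 0 ≤ C ∧ ∀ S : Finset (List Bool), (∀ p ∈ S, ∀ q ∈ S, p <+: q → p = q) →
      ∑ p ∈ S, weight Q D p.length ≤ C := by
  obtain ⟨C, hC0, hC⟩ := exists_weight_le Q hD hD1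
  refine ⟨C, hC0, fun S hS => ?_⟩
  calc ∑ p ∈ S, weight Q D p.length ≤ ∑ p ∈ S, C * (1 / 2) ^ p.length :=
        Finset.sum_le_sum fun p _ => hC _
    _ = C * ∑ p ∈ S, (1 / 2) ^ p.length := by rw [Finset.mul_sum]
    _ ≤ C * 1 := mul_le_mul_of_nonneg_left (sum_half_pow_length_le_one hS) hC0
    _ = C := mul_one C

theorem summable_term {U : List Bool →. List Bool} (hU : IsComputer U) (Q : ℝ) {D : ℝ}
    (hD : 0 < D) (hD1 : D < 1) : Summable fun p : Dom U => term Q D p.1 := by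
  obtain ⟨C, -, hC⟩ := exists_sum_weight_le Q hD hD1
  refine summable_of_sum_le (c := C) (fun p => term_nonneg _ _ _) fun S => ?_
  have := hC (S.map (Function.Embedding.subtype _)) (by
    intro p hp q hq h
    simp only [Finset.mem_map, Function.Embedding.subtype_apply, Subtype.exists,
      exists_and_right, exists_eq_right] at hp hq
    exact hU.2 p q hp.1 hq.1 h)
  simpa [term_eq_weight] using this

/-! ### Effective approximation of the weights -/

theorem ComputableReal.exists_nat_approx {T : ℝ} (hT : ComputableReal T) (h0 : 0 ≤ T) :
    ∃ x : ℕ → ℕ, Computable x ∧ ∀ N : ℕ, |N * T - x N| ≤ 2 := by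
  obtain ⟨f, ⟨a, b, c, ha, hb, hc, hf⟩, hT⟩ := hT
  refine ⟨fun N => N * (a N - b N) / (c N + 1), ?_, fun N => ?_⟩
  · exact Primrec.nat_div.to_comp.comp (Primrec.nat_mul.to_comp.comp Computable.id
      (Primrec.nat_sub.to_comp.comp ha hb)) (Computable.succ.comp hc)
  rcases Nat.eq_zero_or_pos N with rfl | hN
  · simp
  have hN' : (0 : ℝ) < N := by exact_mod_cast hN
  have h1 := hT N hN
  set g : ℝ := ((a N - b N : ℕ) : ℝ) / ((c N : ℝ) + 1) with hg
  have hc' : (0 : ℝ) < (c N : ℝ) + 1 := by positivity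
  -- Truncated subtraction replaces a negative approximation by `0`, which is no farther from `T ≥
  -- 0`.
  have h2 : |T - g| ≤ |T - (f N : ℝ)| := by
    have hfN : (f N : ℝ) = ((a N : ℝ) - b N) / ((c N : ℝ) + 1) := by rw [hf N]; push_cast; rfl
    rcases le_total (b N) (a N) with h | h
    · rw [hg, hfN, Nat.cast_sub h]
    · have hg0 : g = 0 := by rw [hg, Nat.sub_eq_zero_of_le h]; simp
      have hf0 : (f N : ℝ) ≤ 0 := by
        rw [hfN]
        have : (a N : ℝ) ≤ b N := by exact_mod_cast h
        exact div_nonpos_of_nonpos_of_nonneg (by linarith) hc'.le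
      rw [hg0, sub_zero, abs_of_nonneg h0, abs_of_nonneg (by linarith)]
      linarith
  have h3 : |N * T - N * g| ≤ 1 := by
    rw [← mul_sub, abs_mul, abs_of_pos hN']
    calc (N : ℝ) * |T - g| ≤ N * (1 / N) :=
          mul_le_mul_of_nonneg_left (h2.trans h1.le) hN'.le
      _ = 1 := by field_simp
  have h4 : N * (a N - b N) / (c N + 1) = ⌊N * g⌋₊ := by
    rw [hg, ← mul_div_assoc]
    exact_mod_cast (Nat.floor_div_eq_div (K := ℝ) (N * (a N - b N)) (c N + 1)).symm
  change |N * T - ((N * (a N - b N) / (c N + 1) : ℕ) : ℝ)| ≤ 2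
  rw [h4]
  have h5 := Nat.floor_le (show 0 ≤ N * g by positivity)
  have h6 := Nat.lt_floor_add_one (N * g)
  rw [abs_le] at h3 ⊢
  constructor <;> linarith

/-- The power `N * d` clears the denominators of both exponents `x / N` and `ℓ * N / d`. -/
theorem two_pow_mul_weight_pow {n ℓ N x d : ℕ} (hN : 0 < N) (hd : 0 < d) :
    ((2 : ℝ) ^ n * weight (x / N) (d / N) ℓ) ^ (N * d) =
      2 ^ (n * N * d) * ℓ ^ (x * d) / 2 ^ (ℓ * N * N) := by
  have hN' : (0 : ℝ) < N := by exact_mod_cast hN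
  have hd' : (0 : ℝ) < d := by exact_mod_cast hd
  rw [mul_pow, ← Real.rpow_natCast (weight _ _ _), weight_rpow, ← pow_mul, mul_div_assoc,
    mul_assoc n]
  congr 1
  unfold weight
  rw [div_eq_mul_inv ((ℓ : ℝ) ^ (x * d)), ← Real.rpow_natCast (ℓ : ℝ), ← Real.rpow_natCast (2 : ℝ),
    ← Real.rpow_neg two_pos.le]
  push_cast
  congr 2 <;> field_simp

/-- Comparison of `a` with `2 ^ n * ℓ ^ (x / N) * 2 ^ (-ℓ / (d / N))` by integer arithmetic. -/
theorem le_two_pow_mul_weight_iff {a n ℓ N x d : ℕ} (hN : 0 < N) (hd : 0 < d) :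
    (a : ℝ) ≤ 2 ^ n * weight (x / N) (d / N) ℓ ↔
      a ^ (N * d) * 2 ^ (ℓ * N * N) ≤ 2 ^ (n * N * d) * ℓ ^ (x * d) := by
  rw [← pow_le_pow_iff_left₀ (a := (a : ℝ)) (Nat.cast_nonneg a)
    (mul_nonneg (by positivity) (weight_nonneg _ _ ℓ)) (mul_pos hN hd).ne',
    two_pow_mul_weight_pow hN hd, le_div_iff₀ (by positivity)]
  exact_mod_cast Iff.rfl

theorem two_pow_mul_weight_le_iff {a n ℓ N x d : ℕ} (hN : 0 < N) (hd : 0 < d) :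
    2 ^ n * weight (x / N) (d / N) ℓ ≤ (a : ℝ) ↔
      2 ^ (n * N * d) * ℓ ^ (x * d) ≤ a ^ (N * d) * 2 ^ (ℓ * N * N) := by
  rw [← pow_le_pow_iff_left₀ (b := (a : ℝ)) (mul_nonneg (by positivity) (weight_nonneg _ _ ℓ))
    (Nat.cast_nonneg a) (mul_pos hN hd).ne',
    two_pow_mul_weight_pow hN hd, div_le_iff₀ (by positivity)]
  exact_mod_cast Iff.rfl

theorem weight_mono {Q D Q' D' : ℝ} {ℓ : ℕ} (hℓ : 0 < ℓ) (hQ : Q ≤ Q') (hD : 0 < D)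
    (hDD' : D ≤ D') : weight Q D ℓ ≤ weight Q' D' ℓ := by
  have hℓ1 : (1 : ℝ) ≤ ℓ := by exact_mod_cast hℓ
  unfold weight
  refine mul_le_mul (Real.rpow_le_rpow_of_exponent_le hℓ1 hQ)
    (Real.rpow_le_rpow_of_exponent_le one_le_two ?_) (by positivity) (by positivity)
  rw [neg_div, neg_div]
  exact neg_le_neg (div_le_div_of_nonneg_left (by positivity) hD hDD')

theorem tendsto_weight {Q D : ℝ} {q d : ℕ → ℝ} {ℓ : ℕ} (hℓ : 0 < ℓ) (hD : 0 < D)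
    (hq : Tendsto q atTop (𝓝 Q)) (hd : Tendsto d atTop (𝓝 D)) :
    Tendsto (fun N => weight (q N) (d N) ℓ) atTop (𝓝 (weight Q D ℓ)) := by
  have hℓ1 : (0 : ℝ) < ℓ := by exact_mod_cast hℓ
  unfold weight
  refine (tendsto_const_nhds.rpow hq (Or.inl hℓ1.ne')).mul
    (tendsto_const_nhds.rpow (tendsto_const_nhds.div hd hD.ne') (Or.inl two_ne_zero))

theorem tendsto_div_of_abs_sub_le {T : ℝ} {y : ℕ → ℕ} {K : ℝ}
    (h : ∀ N : ℕ, |N * T - y N| ≤ K) : Tendsto (fun N : ℕ => (y N : ℝ) / N) atTop (𝓝 T) := by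
  rw [tendsto_iff_dist_tendsto_zero]
  refine squeeze_zero' (Eventually.of_forall fun _ => dist_nonneg) ?_
    (tendsto_const_div_atTop_nhds_zero_nat K)
  filter_upwards [eventually_gt_atTop 0] with N hN
  have hN' : (0 : ℝ) < N := by exact_mod_cast hN
  rw [Real.dist_eq, abs_sub_comm, le_div_iff₀ hN', ← abs_of_pos hN', ← abs_mul, abs_of_pos hN']
  have h1 : (y N : ℝ) / N * N = y N := div_mul_cancel₀ _ hN'.ne'
  rw [sub_mul, h1, mul_comm T]
  exact h N

/-- Shifting by the error makes the approximation one-sided, so `weight_mono` turns it into a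
certified bound. -/
theorem abs_sub_natSub_le {t : ℝ} {x : ℕ} (ht : 0 ≤ t) (h : |t - x| ≤ 2) :
    |t - ((x - 2 : ℕ) : ℝ)| ≤ 4 ∧ ((x - 2 : ℕ) : ℝ) ≤ t := by
  rw [abs_le] at h ⊢
  rcases le_total 2 x with h2 | h2
  · push_cast [Nat.cast_sub h2]
    refine ⟨⟨?_, ?_⟩, ?_⟩ <;> linarith
  · have h3 : (x : ℝ) ≤ 2 := by exact_mod_cast h2
    rw [Nat.sub_eq_zero_of_le h2, Nat.cast_zero]
    refine ⟨⟨?_, ?_⟩, ?_⟩ <;> linarith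

theorem abs_sub_natAdd_le {t : ℝ} {x : ℕ} (h : |t - x| ≤ 2) :
    |t - ((x + 2 : ℕ) : ℝ)| ≤ 4 ∧ t ≤ ((x + 2 : ℕ) : ℝ) := by
  rw [abs_le] at h ⊢
  push_cast
  refine ⟨⟨?_, ?_⟩, ?_⟩ <;> linarith

/-- The weights are computable real numbers, uniformly in the length. -/
theorem exists_weight_approx {Q D : ℝ} (hQ : 0 < Q) (hD : 0 < D) (hQc : ComputableReal Q)
    (hDc : ComputableReal D) :
    ∃ A : ℕ → ℕ → ℕ, Computable₂ A ∧ ∀ ℓ n, (A ℓ n : ℝ) ≤ 2 ^ n * weight Q D ℓ ∧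
      2 ^ n * weight Q D ℓ ≤ A ℓ n + 2 := by
  obtain ⟨x, hxc, hx⟩ := hQc.exists_nat_approx hQ.le
  obtain ⟨y, hyc, hy⟩ := hDc.exists_nat_approx hD.le
  -- With `m` coding `(a, N)`, this integer condition certifies `a ≤ 2 ^ n * weight Q D ℓ ≤ a + 2`,
  -- using parameters rounded down and then up at precision `N`. The length `0` is separate: its
  -- weight is `0` and monotonicity in the exponent needs `ℓ ≥ 1`.
  let P : ℕ × ℕ → ℕ → Prop := fun i m => (i.1 = 0 ∧ m.unpair.1 = 0) ∨
    (0 < i.1 ∧ 0 < m.unpair.2 ∧ 0 < y m.unpair.2 - 2 ∧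
    m.unpair.1 ^ (m.unpair.2 * (y m.unpair.2 - 2)) * 2 ^ (i.1 * m.unpair.2 * m.unpair.2) ≤
      2 ^ (i.2 * m.unpair.2 * (y m.unpair.2 - 2)) *
        i.1 ^ ((x m.unpair.2 - 2) * (y m.unpair.2 - 2)) ∧
    2 ^ (i.2 * m.unpair.2 * (y m.unpair.2 + 2)) * i.1 ^ ((x m.unpair.2 + 2) * (y m.unpair.2 + 2)) ≤
      (m.unpair.1 + 2) ^ (m.unpair.2 * (y m.unpair.2 + 2)) *
        2 ^ (i.1 * m.unpair.2 * m.unpair.2))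
  have : DecidableRel P := fun i m => by unfold P; infer_instance
  have hPc : ComputablePred fun p : (ℕ × ℕ) × ℕ => P p.1 p.2 := by
    have add {f g : (ℕ × ℕ) × ℕ → ℕ} (hf : Computable f) (hg : Computable g) :
      Computable fun p => f p + g p := Primrec.nat_add.to_comp.comp hf hg
    have sub {f g : (ℕ × ℕ) × ℕ → ℕ} (hf : Computable f) (hg : Computable g) :
      Computable fun p => f p - g p := Primrec.nat_sub.to_comp.comp hf hg
    have mul {f g : (ℕ × ℕ) × ℕ → ℕ} (hf : Computable f) (hg : Computable g) :
      Computable fun p => f p * g p := Primrec.nat_mul.to_comp.comp hf hg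
    have pow {f g : (ℕ × ℕ) × ℕ → ℕ} (hf : Computable f) (hg : Computable g) :
      Computable fun p => f p ^ g p := primrec_pow.to_comp.comp hf hg
    have le {f g : (ℕ × ℕ) × ℕ → ℕ} (hf : Computable f) (hg : Computable g) :
      Computable fun p => decide (f p ≤ g p) :=
        (PrimrecRel.decide Primrec.nat_le).to_comp.comp hf hg
    have lt {f g : (ℕ × ℕ) × ℕ → ℕ} (hf : Computable f) (hg : Computable g) :
      Computable fun p => decide (f p < g p) :=
        (PrimrecRel.decide Primrec.nat_lt).to_comp.comp hf hg
    have and {f g : (ℕ × ℕ) × ℕ → Bool} (hf : Computable f) (hg : Computable g) :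
      Computable fun p => f p && g p := Primrec.and.to_comp.comp hf hg
    have or {f g : (ℕ × ℕ) × ℕ → Bool} (hf : Computable f) (hg : Computable g) :
      Computable fun p => f p || g p := Primrec.or.to_comp.comp hf hg
    have c (k : ℕ) : Computable fun _ : (ℕ × ℕ) × ℕ => k := Computable.const k
    have hℓ : Computable fun p : (ℕ × ℕ) × ℕ => p.1.1 := Computable.fst.comp Computable.fst
    have hn : Computable fun p : (ℕ × ℕ) × ℕ => p.1.2 := Computable.snd.comp Computable.fst
    have ha : Computable fun p : (ℕ × ℕ) × ℕ => p.2.unpair.1 :=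
      Computable.fst.comp (Computable.unpair.comp Computable.snd)
    have hN : Computable fun p : (ℕ × ℕ) × ℕ => p.2.unpair.2 :=
      Computable.snd.comp (Computable.unpair.comp Computable.snd)
    have hx := hxc.comp hN
    have hy := hyc.comp hN
    refine Computable.computablePred (Computable.of_eq (f := fun p : (ℕ × ℕ) × ℕ =>
      (decide (p.1.1 = 0) && decide (p.2.unpair.1 = 0)) || (_ && (_ && (_ && (_ && _)))))
      (or (and (computable_decide_eq hℓ (c 0)) (computable_decide_eq ha (c 0)))
        (and (lt (c 0) hℓ) (and (lt (c 0) hN) (and (lt (c 0) (sub hy (c 2)))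
        (and (le (mul (pow ha (mul hN (sub hy (c 2)))) (pow (c 2) (mul (mul hℓ hN) hN)))
          (mul (pow (c 2) (mul (mul hn hN) (sub hy (c 2))))
            (pow hℓ (mul (sub hx (c 2)) (sub hy (c 2))))))
          (le (mul (pow (c 2) (mul (mul hn hN) (add hy (c 2))))
            (pow hℓ (mul (add hx (c 2)) (add hy (c 2)))))
            (mul (pow (add ha (c 2)) (mul hN (add hy (c 2))))
              (pow (c 2) (mul (mul hℓ hN) hN))))))))) fun p => ?_)
    simp [P]
  have hPe : ∀ i, ∃ m, P i m := by
    rintro ⟨ℓ, n⟩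
    rcases Nat.eq_zero_or_pos ℓ with rfl | hℓ
    · exact ⟨0, Or.inl ⟨rfl, by simp⟩⟩
    have hpos : 0 < 2 ^ n * weight Q D ℓ := by
      have : (0 : ℝ) < ℓ := by exact_mod_cast hℓ
      unfold weight; positivity
    have hlow : Tendsto (fun N : ℕ => (2 : ℝ) ^ n *
        weight ((x N - 2 : ℕ) / N) ((y N - 2 : ℕ) / N) ℓ) atTop (𝓝 (2 ^ n * weight Q D ℓ)) :=
      (tendsto_weight hℓ hD
        (tendsto_div_of_abs_sub_le fun N => (abs_sub_natSub_le (by positivity) (hx N)).1)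
        (tendsto_div_of_abs_sub_le fun N => (abs_sub_natSub_le (by positivity) (hy N)).1)).const_mul
        _
    have hupp : Tendsto (fun N : ℕ => (2 : ℝ) ^ n *
        weight ((x N + 2 : ℕ) / N) ((y N + 2 : ℕ) / N) ℓ) atTop (𝓝 (2 ^ n * weight Q D ℓ)) :=
      (tendsto_weight hℓ hD
        (tendsto_div_of_abs_sub_le fun N => (abs_sub_natAdd_le (hx N)).1)
        (tendsto_div_of_abs_sub_le fun N => (abs_sub_natAdd_le (hy N)).1)).const_mul _
    have hy0 : Tendsto (fun N : ℕ => ((y N - 2 : ℕ) : ℝ) / N) atTop (𝓝 D) :=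
      tendsto_div_of_abs_sub_le fun N => (abs_sub_natSub_le (by positivity) (hy N)).1
    -- The slack `2` leaves room for strict inequalities on both sides, which persist for the
    -- rounded parameters at large `N`.
    obtain ⟨a, ha⟩ : ∃ a : ℕ, ⌈2 ^ n * weight Q D ℓ⌉₊ = a + 1 :=
      Nat.exists_eq_succ_of_ne_zero (Nat.ceil_pos.2 hpos).ne'
    have ha1 : (a : ℝ) < 2 ^ n * weight Q D ℓ := Nat.lt_ceil.1 (by omega)
    have ha2 : 2 ^ n * weight Q D ℓ < (a + 2 : ℕ) := by
      have := Nat.le_ceil (2 ^ n * weight Q D ℓ)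
      rw [ha] at this
      push_cast at this ⊢
      linarith
    obtain ⟨N, h1, h2, h3, h4⟩ := ((hlow.eventually (lt_mem_nhds ha1)).and
      ((hupp.eventually (gt_mem_nhds ha2)).and
        ((hy0.eventually (lt_mem_nhds hD)).and (eventually_gt_atTop 0)))).exists
    have h5 : 0 < y N - 2 := by
      by_contra h
      rw [Nat.eq_zero_of_not_pos h] at h3
      simp at h3
    refine ⟨Nat.pair a N, Or.inr ?_⟩
    simp only [Nat.unpair_pair]
    exact ⟨hℓ, h4, h5, (le_two_pow_mul_weight_iff h4 h5).1 h1.le,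
      (two_pow_mul_weight_le_iff h4 (by omega)).1 h2.le⟩
  refine ⟨fun ℓ n => (Nat.find (hPe (ℓ, n))).unpair.1, ?_, fun ℓ n => ?_⟩
  · exact Computable.fst.comp (Computable.unpair.comp (Computable.find hPc hPe))
  · beta_reduce
    have h := Nat.find_spec (hPe (ℓ, n))
    generalize Nat.find (hPe (ℓ, n)) = m at h
    rcases h with ⟨h1, h2⟩ | ⟨h1, h2, h3, h4, h5⟩
    · simp only at h1
      subst h1
      rw [h2]
      simp [weight, hQ.ne']
    · simp only at h1 h4 h5
      rw [← le_two_pow_mul_weight_iff h2 h3] at h4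
      rw [← two_pow_mul_weight_le_iff h2 (by omega)] at h5
      have hN : (0 : ℝ) < (m.unpair.2 : ℝ) := by exact_mod_cast h2
      have hd : (0 : ℝ) < ((y m.unpair.2 - 2 : ℕ) : ℝ) := by exact_mod_cast h3
      refine ⟨h4.trans (mul_le_mul_of_nonneg_left ?_ (by positivity)),
        (mul_le_mul_of_nonneg_left ?_ (by positivity)).trans (h5.trans_eq (by push_cast; rfl))⟩
      · refine weight_mono h1 ?_ (by positivity) ?_ <;> rw [div_le_iff₀' hN]
        · exact (abs_sub_natSub_le (by positivity) (hx _)).2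
        · exact (abs_sub_natSub_le (by positivity) (hy _)).2
      · refine weight_mono h1 ?_ hD ?_ <;> rw [le_div_iff₀' hN]
        · exact (abs_sub_natAdd_le (hx _)).2
        · exact (abs_sub_natAdd_le (hy _)).2

/-! ### Approximation of `W` from below -/

/-- An enumeration `e` of the graph of `U` together with lower approximations of the partial sums
of the series `W`: the number `V n k / 2 ^ (n + k + 1)` approximates the sum of the first `k` terms
up to `2 ^ (-n)`. -/
structure LowerApprox (U : List Bool →. List Bool) (Q D : ℝ) where
  e : ℕ → Option (List Bool × List Bool)
  V : ℕ → ℕ → ℕ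
  computable_e : Computable e
  sound : ∀ m p s, e m = some (p, s) → s ∈ U p
  complete : ∀ p s, s ∈ U p → ∃ m, e m = some (p, s)
  injective : ∀ m m' p s s', e m = some (p, s) → e m' = some (p, s') → m = m'
  computable_V : Computable₂ V
  V_zero : ∀ n, V n 0 = 0
  increment : ∀ n k, ∃ c : ℝ, 0 ≤ c ∧ c ≤ (e k).elim 0 (fun x => term Q D x.1) ∧
    (e k).elim 0 (fun x => term Q D x.1) ≤ c + (1 / 2) ^ (n + k + 1) ∧
    (V n (k + 1) : ℝ) / 2 ^ (n + (k + 1) + 1) = V n k / 2 ^ (n + k + 1) + c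

/-- The doubling recursion for partial sums with growing precision. -/
def approxSum (e : ℕ → Option (List Bool × List Bool)) (A : ℕ → ℕ → ℕ) (n : ℕ) : ℕ → ℕ
  | 0 => 0
  | k + 1 => 2 * approxSum e A n k + ((e k).map fun x => A x.1.length (n + k + 2)).getD 0

theorem computable_approxSum {e : ℕ → Option (List Bool × List Bool)} {A : ℕ → ℕ → ℕ}
    (he : Computable e) (hA : Computable₂ A) : Computable₂ (approxSum e A) := by
  have h := Computable.nat_rec (α := ℕ × ℕ) (σ := ℕ) (f := fun p => p.2) (g := fun _ => 0)
    (h := fun p y => 2 * y.2 + ((e y.1).map fun x => A x.1.length (p.1 + y.1 + 2)).getD 0)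
    Computable.snd (Computable.const 0) (by
      refine Primrec.nat_add.to_comp.comp (Primrec.nat_mul.to_comp.comp (Computable.const 2)
        (Computable.snd.comp Computable.snd)) ?_
      refine Computable.option_getD (Computable.option_map
        (he.comp (Computable.fst.comp Computable.snd)) ?_) (Computable.const 0)
      refine hA.comp (Computable.list_length.comp (Computable.fst.comp Computable.snd)) ?_
      exact Primrec.nat_add.to_comp.comp (Primrec.nat_add.to_comp.comp
        (Computable.fst.comp (Computable.fst.comp Computable.fst))
        (Computable.fst.comp (Computable.snd.comp Computable.fst))) (Computable.const 2))
  refine h.of_eq fun p => ?_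
  obtain ⟨n, k⟩ := p
  induction k with
  | zero => rfl
  | succ k ih =>
    simp only at ih ⊢
    rw [approxSum, ← ih]

theorem exists_lowerApprox {U : List Bool →. List Bool} (hU : Partrec U) {Q D : ℝ} (hQ : 0 < Q)
    (hD : 0 < D) (hQc : ComputableReal Q) (hDc : ComputableReal D) :
    Nonempty (LowerApprox U Q D) := by
  obtain ⟨e, he, h1, h2, h3⟩ := exists_enumeration hU
  obtain ⟨A, hA, hA'⟩ := exists_weight_approx hQ hD hQc hDc
  refine ⟨⟨e, approxSum e A, he, h1, h2, h3, computable_approxSum he hA, fun _ => rfl,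
    fun n k => ?_⟩⟩
  -- The error `2` of `A` at scale `2 ^ (n + k + 2)` is the allowed `(1 / 2) ^ (n + k + 1)`.
  refine ⟨(((e k).map fun x => A x.1.length (n + k + 2)).getD 0 : ℕ) / 2 ^ (n + k + 2),
    by positivity, ?_, ?_, ?_⟩
  · cases e k with
    | none => simp
    | some x =>
      simp only [Option.map_some, Option.getD_some, Option.elim_some, term_eq_weight]
      rw [div_le_iff₀' (by positivity)]
      exact (hA' _ _).1
  · cases e k with
    | none => simp
    | some x =>
      simp only [Option.map_some, Option.getD_some, Option.elim_some, term_eq_weight]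
      have := (hA' x.1.length (n + k + 2)).2
      rw [one_div_pow, ← mul_le_mul_iff_right₀ (show (0 : ℝ) < 2 ^ (n + k + 2) by positivity)]
      refine this.trans (le_of_eq ?_)
      rw [pow_succ 2 (n + k + 1)]
      field_simp
  · rw [approxSum]
    push_cast
    rw [show n + (k + 1) + 1 = n + k + 1 + 1 by ring, pow_succ 2 (n + k + 1)]
    field_simp

namespace LowerApprox

variable {U : List Bool →. List Bool} {Q D : ℝ}

/-- Each program occurs at exactly one index and the other indices contribute `0`. The function `f`
is arbitrary because the `r`-th powers of the terms are summed this way too. -/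
theorem hasSum_elim (a : LowerApprox U Q D) {f : List Bool → ℝ} {S : ℝ}
    (hS : HasSum (fun p : Dom U => f p.1) S) :
    HasSum (fun m => (a.e m).elim 0 fun x => f x.1) S := by
  choose g hg using fun p : Dom U => a.complete p.1 ((U p.1).get p.2) (Part.get_mem p.2)
  have hinj : Function.Injective g := by
    intro p q h
    have h1 := hg p
    rw [h, hg q] at h1
    exact Subtype.ext (Prod.mk.inj (Option.some.inj h1)).1.symm
  have hzero : ∀ m ∉ Set.range g, ((a.e m).elim 0 fun x => f x.1) = 0 := by
    intro m hm
    cases h : a.e m with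
    | none => rfl
    | some x =>
      obtain ⟨p, s⟩ := x
      have hs := a.sound m p s h
      refine absurd ⟨⟨p, Part.dom_iff_mem.2 ⟨s, hs⟩⟩, ?_⟩ hm
      exact a.injective _ _ _ _ _ (hg _) h
  rw [← hinj.hasSum_iff hzero]
  convert hS using 2 with p
  simp [hg p]

/-- The `m`-th term of the enumerated series. -/
noncomputable def seq (a : LowerApprox U Q D) (m : ℕ) : ℝ := (a.e m).elim 0 fun x => term Q D x.1

/-- The lower approximation of precision `2 ^ (-n)` to the sum of the first `k` terms. -/
noncomputable def low (a : LowerApprox U Q D) (n k : ℕ) : ℝ := (a.V n k : ℝ) / 2 ^ (n + k + 1)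

theorem seq_nonneg (a : LowerApprox U Q D) (m : ℕ) : 0 ≤ a.seq m := by
  unfold seq
  cases a.e m with
  | none => exact le_rfl
  | some x => exact term_nonneg _ _ _

theorem low_zero (a : LowerApprox U Q D) (n : ℕ) : a.low n 0 = 0 := by simp [low, a.V_zero]

theorem exists_low_succ (a : LowerApprox U Q D) (n k : ℕ) : ∃ c : ℝ, 0 ≤ c ∧ c ≤ a.seq k ∧
    a.seq k ≤ c + (1 / 2) ^ (n + k + 1) ∧ a.low n (k + 1) = a.low n k + c :=
  a.increment n k

theorem low_le_sum (a : LowerApprox U Q D) (n k : ℕ) : a.low n k ≤ ∑ m ∈ Finset.range k, a.seq m := by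
  induction k with
  | zero => simp [low_zero]
  | succ k ih =>
    obtain ⟨c, -, h1, -, h2⟩ := a.exists_low_succ n k
    rw [Finset.sum_range_succ, h2]
    linarith

theorem sum_le_low_add (a : LowerApprox U Q D) (n k : ℕ) :
    ∑ m ∈ Finset.range k, a.seq m ≤ a.low n k + (1 / 2) ^ n := by
  -- The errors `(1 / 2) ^ (n + i + 1)` for `i < k` add up to exactly this difference.
  suffices h : ∑ m ∈ Finset.range k, a.seq m ≤
      a.low n k + ((1 / 2) ^ n - (1 / 2) ^ (n + k)) by
    have : (0 : ℝ) < (1 / 2) ^ (n + k) := by positivity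
    linarith
  induction k with
  | zero => simp [low_zero]
  | succ k ih =>
    obtain ⟨c, -, -, h1, h2⟩ := a.exists_low_succ n k
    rw [Finset.sum_range_succ, h2]
    have : (1 / 2 : ℝ) ^ (n + k) = 2 * (1 / 2) ^ (n + k + 1) := by rw [pow_succ]; ring
    rw [← add_assoc n k 1]
    linarith

theorem hasSum_seq (a : LowerApprox U Q D) (hU : IsComputer U) (hD : 0 < D) (hD1 : D < 1) :
    HasSum a.seq (W U Q D) :=
  a.hasSum_elim (summable_term hU Q hD hD1).hasSum

theorem low_le_W (a : LowerApprox U Q D) (hU : IsComputer U) (hD : 0 < D) (hD1 : D < 1) (n k : ℕ) :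
    a.low n k ≤ W U Q D :=
  (a.low_le_sum n k).trans
    (sum_le_hasSum _ (fun m _ => a.seq_nonneg m) (a.hasSum_seq hU hD hD1))

theorem leftComputable_W (a : LowerApprox U Q D) (hU : IsComputer U) (hD : 0 < D) (hD1 : D < 1) :
    LeftComputable (W U Q D) := by
  refine ⟨fun n => -(a.V n n / 2 ^ (n + n + 1)), ?_, fun n _ => ?_, ?_⟩
  · refine ⟨fun _ => 0, fun n => a.V n n, fun n => 2 ^ (n + n + 1) - 1, Computable.const 0,
      a.computable_V.comp Computable.id Computable.id, ?_, fun n => ?_⟩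
    · refine Primrec.to_comp (Primrec.nat_sub.comp (primrec_pow.comp (Primrec.const 2) ?_)
        (Primrec.const 1))
      exact Primrec.succ.comp (Primrec.nat_add.comp Primrec.id Primrec.id)
    · rw [Nat.cast_sub Nat.one_le_two_pow]
      push_cast
      ring
  · push_cast
    exact neg_le_neg (a.low_le_W hU hD hD1 n n)
  · push_cast
    refine Tendsto.neg ?_
    have h1 := (a.hasSum_seq hU hD hD1).tendsto_sum_nat
    have h2 : Tendsto (fun n => ∑ m ∈ Finset.range n, a.seq m - (1 / 2) ^ n) atTop
        (𝓝 (W U Q D)) := by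
      simpa using h1.sub (tendsto_pow_atTop_nhds_zero_of_lt_one (r := (1 / 2 : ℝ)) (by norm_num)
        (by norm_num))
    exact tendsto_of_tendsto_of_tendsto_of_le_of_le h2 h1
      (fun n => by have := a.sum_le_low_add n n; simp only [low] at this; dsimp only; linarith)
      (fun n => a.low_le_sum n n)

end LowerApprox

/-! ### Randomness -/

/-- Otherwise `[]` would be the only program, yet two different strings need programs. Complexities
are therefore positive and have nonnegative logarithms. -/
theorem IsOptimal.nil_not_dom {U : List Bool →. List Bool} (hU : IsOptimal U) :
    ¬ (U []).Dom := by
  intro h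
  obtain ⟨p, hp⟩ := hU.exists_program []
  obtain ⟨q, hq⟩ := hU.exists_program [true]
  have hp' := hU.1.2 [] p h (Part.dom_iff_mem.2 ⟨_, hp⟩) List.nil_prefix
  have hq' := hU.1.2 [] q h (Part.dom_iff_mem.2 ⟨_, hq⟩) List.nil_prefix
  subst hp' hq'
  simpa using Part.mem_unique hp hq

theorem tendsto_sub_of_weight_le {Q D : ℝ} (hQ : 0 < Q) (hD : 0 < D) {h : ℕ → ℕ}
    (h0 : ∀ n, 0 < h n) (hw : ∀ n, weight Q D (h n) ≤ 3 / 2 ^ n) :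
    Tendsto (fun n : ℕ => (h n : ℝ) - D * n) atTop atTop := by
  have hlog2 : 0 < Real.log 2 := Real.log_pos one_lt_two
  have key : ∀ n, D / Real.log 2 * (Q * Real.log (h n) - Real.log 3) ≤ (h n : ℝ) - D * n := by
    intro n
    have hn : (0 : ℝ) < h n := by exact_mod_cast h0 n
    have h1 := Real.log_le_log (by unfold weight; positivity) (hw n)
    unfold weight at h1
    rw [Real.log_mul (by positivity) (by positivity), Real.log_rpow hn, Real.log_rpow two_pos,
      Real.log_div (by norm_num) (by positivity), Real.log_pow] at h1
    have h2 : Q * Real.log (h n) - Real.log 3 ≤ ((h n : ℝ) / D - n) * Real.log 2 := by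
      rw [neg_div] at h1
      linarith
    calc D / Real.log 2 * (Q * Real.log (h n) - Real.log 3)
        ≤ D / Real.log 2 * (((h n : ℝ) / D - n) * Real.log 2) :=
          mul_le_mul_of_nonneg_left h2 (by positivity)
      _ = (h n : ℝ) - D * n := by field_simp
  -- Bootstrap: with only `log (h n) ≥ 0`, `key` already gives linear growth; then `Q * log (h n)`
  -- tends to infinity.
  have hlin : Tendsto (fun n : ℕ => (h n : ℝ)) atTop atTop := by
    have : Tendsto (fun n : ℕ => D * (n : ℝ) + D / Real.log 2 * (-Real.log 3)) atTop atTop :=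
      tendsto_atTop_add_const_right _ _ (tendsto_natCast_atTop_atTop.const_mul_atTop hD)
    refine tendsto_atTop_mono (fun n => ?_) this
    have h1 : 0 ≤ Real.log (h n) := Real.log_nonneg (by exact_mod_cast h0 n)
    have h2 : D / Real.log 2 * (-Real.log 3) ≤
        D / Real.log 2 * (Q * Real.log (h n) - Real.log 3) :=
      mul_le_mul_of_nonneg_left (by nlinarith) (by positivity)
    linarith [key n]
  refine tendsto_atTop_mono key ?_
  refine Tendsto.const_mul_atTop (by positivity) ?_
  exact tendsto_atTop_add_const_right _ _ ((Real.tendsto_log_atTop.comp hlin).const_mul_atTop hQ)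

/-- A bound for the lengths of the outputs among the first `k` entries of an enumeration. -/
def outputBound (e : ℕ → Option (List Bool × List Bool)) : ℕ → ℕ
  | 0 => 0
  | k + 1 => outputBound e k + ((e k).map fun x => x.2.length + 1).getD 0

theorem computable_outputBound {e : ℕ → Option (List Bool × List Bool)} (he : Computable e) :
    Computable (outputBound e) := by
  have h := Computable.nat_rec (α := ℕ) (σ := ℕ) (f := fun p => p) (g := fun _ => 0)
    (h := fun _ y => y.2 + ((e y.1).map fun x => x.2.length + 1).getD 0)
    Computable.id (Computable.const 0) (by
      refine Primrec.nat_add.to_comp.comp (Computable.snd.comp Computable.snd) ?_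
      refine Computable.option_getD (Computable.option_map
        (he.comp (Computable.fst.comp Computable.snd)) ?_) (Computable.const 0)
      exact Computable.succ.comp
        (Computable.list_length.comp (Computable.snd.comp Computable.snd)))
  refine h.of_eq fun k => ?_
  induction k with
  | zero => rfl
  | succ k ih =>
    simp only at ih ⊢
    rw [outputBound, ← ih]

theorem length_lt_outputBound {e : ℕ → Option (List Bool × List Bool)} {k m : ℕ} (hm : m < k)
    {p s : List Bool} (h : e m = some (p, s)) : s.length < outputBound e k := by
  induction k with
  | zero => omega
  | succ k ih =>
    rw [outputBound]
    rcases Nat.lt_succ_iff_lt_or_eq.1 hm with h' | rfl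
    · have := ih h'
      omega
    · simp only [h, Option.map_some, Option.getD_some]
      omega

theorem LowerApprox.chaitinRandom {U : List Bool →. List Bool} {Q D : ℝ}
    (a : LowerApprox U Q D) (hU : IsOptimal U) (hQ : 0 < Q) (hD : 0 < D) (hD1 : D < 1) :
    ChaitinRandom U D (bits (W U Q D)) := by
  have hsum := a.hasSum_seq hU.1 hD hD1
  have hW0 : 0 ≤ W U Q D := hsum.nonneg a.seq_nonneg
  set fl : ℕ := ⌊W U Q D⌋₊ with hfl
  -- The bits omit the integer part, so the constant `fl` is built into the test. On the first `n`
  -- bits it reads `⌊2 ^ n * W⌋ < 2 ^ n * low n k + 2`.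
  let found : List Bool → ℕ → Bool := fun s k =>
    decide ((fl * 2 ^ s.length + ofBinary s) * 2 ^ (k + 1) < a.V s.length k + 2 ^ (k + 2))
  have hfound : Computable₂ found := by
    refine (PrimrecRel.decide Primrec.nat_lt).to_comp.comp ?_ ?_
    · refine Primrec.to_comp (Primrec.nat_mul.comp (Primrec.nat_add.comp (Primrec.nat_mul.comp
        (Primrec.const fl) (primrec_pow.comp (Primrec.const 2)
          (Primrec.list_length.comp Primrec.fst))) (primrec_ofBinary.comp Primrec.fst))
        (primrec_pow.comp (Primrec.const 2) (Primrec.succ.comp Primrec.snd)))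
    · refine Primrec.nat_add.to_comp.comp (a.computable_V.comp
        (Computable.list_length.comp Computable.fst) Computable.snd) (Primrec.to_comp
        (primrec_pow.comp (Primrec.const 2) (Primrec.succ.comp (Primrec.succ.comp Primrec.snd))))
  -- The output is longer than every output among the first `k` entries.
  let F : List Bool →. List Bool := fun s =>
    (Nat.rfind fun k => (Part.some (found s k) : Part Bool)).map fun k =>
      List.replicate (outputBound a.e k) true
  have hF : Partrec F := by
    refine (Partrec.rfind hfound.partrec₂).map ?_
    exact primrec_replicate_true.to_comp.comp
      ((computable_outputBound a.computable_e).comp Computable.snd)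
  obtain ⟨c, hc⟩ := hU.exists_program_map hF
  have hpre : ∀ n, ∃ x ∈ F (pre (bits (W U Q D)) n), 0 < H U x ∧
      weight Q D (H U x) ≤ 3 / 2 ^ n := by
    intro n
    set M := ⌊2 ^ n * W U Q D⌋₊ with hM
    have hM1 : (M : ℝ) ≤ 2 ^ n * W U Q D := Nat.floor_le (by positivity)
    have hM2 : 2 ^ n * W U Q D < M + 1 := Nat.lt_floor_add_one _
    have hMfl : fl * 2 ^ n + M % 2 ^ n = M := by
      have : fl = M / 2 ^ n := by
        rw [hM, ← Nat.floor_div_natCast, hfl]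
        congr 1
        push_cast
        field_simp
      rw [this, Nat.div_add_mod']
    have hfound_iff : ∀ k, found (pre (bits (W U Q D)) n) k = true ↔
        (M : ℝ) < 2 ^ n * a.low n k + 2 := by
      intro k
      have h1 : (2 : ℝ) ^ n * a.low n k + 2 = (a.V n k + 2 ^ (k + 2)) / 2 ^ (k + 1) := by
        unfold LowerApprox.low
        rw [show n + k + 1 = n + (k + 1) by ring, pow_add, pow_succ 2 (k + 1)]
        field_simp
      rw [h1, lt_div_iff₀ (by positivity), pre_bits hW0]
      simp only [found, length_toBinary, ofBinary_toBinary, decide_eq_true_eq]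
      rw [← hM, hMfl]
      exact_mod_cast Iff.rfl
    have hex : ∃ k, found (pre (bits (W U Q D)) n) k = true := by
      have h1 : W U Q D - (1 / 2) ^ n < W U Q D := by
        have : (0 : ℝ) < (1 / 2) ^ n := by positivity
        linarith
      obtain ⟨k, hk⟩ := (hsum.tendsto_sum_nat.eventually (lt_mem_nhds h1)).exists
      refine ⟨k, (hfound_iff k).2 ?_⟩
      have h2 := a.sum_le_low_add n k
      have h3 : W U Q D < a.low n k + 2 * (1 / 2) ^ n := by linarith
      calc (M : ℝ) ≤ 2 ^ n * W U Q D := hM1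
        _ < 2 ^ n * (a.low n k + 2 * (1 / 2) ^ n) := by gcongr
        _ = 2 ^ n * a.low n k + 2 := by rw [one_div_pow]; field_simp
    obtain ⟨k, hk, -⟩ := Nat.rfind_min' hex.choose_spec
    refine ⟨_, Part.mem_map _ hk, ?_⟩
    have hk' : (M : ℝ) < 2 ^ n * a.low n k + 2 :=
      (hfound_iff k).1 (by simpa using Nat.rfind_spec hk)
    obtain ⟨p, hp, hpl⟩ := hU.exists_program_length_eq (List.replicate (outputBound a.e k) true)
    obtain ⟨m, hm⟩ := a.complete p _ hp
    have hmk : k ≤ m := by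
      by_contra h
      have := length_lt_outputBound (not_le.1 h) hm
      simp at this
    rw [← hpl]
    refine ⟨?_, ?_⟩
    · refine List.length_pos_iff.2 fun h => hU.nil_not_dom ?_
      rw [← h]
      exact Part.dom_iff_mem.2 ⟨_, hp⟩
    -- As `m ≥ k`, this term fits into `W - low n k`. Scaled by `2 ^ n` that gap is below `(M + 1) -
    -- (M - 2) = 3`.
    · have h1 : ∑ i ∈ insert m (Finset.range k), a.seq i ≤ W U Q D :=
        sum_le_hasSum _ (fun i _ => a.seq_nonneg i) hsum
      rw [Finset.sum_insert (by simpa using hmk)] at h1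
      have h2 := a.low_le_sum n k
      have h3 : a.seq m = weight Q D p.length := by
        simp [LowerApprox.seq, hm, term_eq_weight]
      rw [← h3, le_div_iff₀' (by positivity)]
      have h4 : (2 : ℝ) ^ n * a.seq m ≤ 2 ^ n * (W U Q D - a.low n k) :=
        mul_le_mul_of_nonneg_left (by linarith) (by positivity)
      linarith
  choose x hx hx0 hxw using hpre
  have := tendsto_atTop_add_const_right _ (-(c : ℝ)) (tendsto_sub_of_weight_le hQ hD hx0 hxw)
  refine tendsto_atTop_mono (fun n => ?_) this
  have h1 : ((H U (x n) : ℕ) : ℝ) ≤ H U (pre (bits (W U Q D)) n) + c := by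
    exact_mod_cast hc _ _ (hx n)
  linarith

/-! ### Compressibility -/

/-- The number of indices `i < k` with `v (i + 1) ≠ v i`. -/
def numChanges (v : ℕ → ℕ) : ℕ → ℕ
  | 0 => 0
  | k + 1 => numChanges v k + if v (k + 1) = v k then 0 else 1

theorem numChanges_mono (v : ℕ → ℕ) : Monotone (numChanges v) :=
  monotone_nat_of_le_succ fun k => by rw [numChanges]; omega

theorem eq_of_numChanges_eq {v : ℕ → ℕ} {k l : ℕ} (hkl : k ≤ l)
    (h : numChanges v k = numChanges v l) : v k = v l := by
  induction l, hkl using Nat.le_induction with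
  | base => rfl
  | succ l hl ih =>
    have h1 := numChanges_mono v hl
    rw [numChanges] at h
    split_ifs at h with h2
    · rw [h2]
      exact ih (by omega)
    · omega

/-- The integer part of a nondecreasing sequence changes at most as often as its increments,
truncated at `1`, allow. -/
theorem numChanges_floor_le {x c : ℕ → ℝ} (hx : x 0 = 0) (hc : ∀ k, 0 ≤ c k)
    (hxc : ∀ k, x (k + 1) = x k + c k) (k : ℕ) :
    (numChanges (fun i => ⌊x i⌋₊) k : ℝ) ≤ 2 * ∑ i ∈ Finset.range k, min 1 (c i) := by
  have hx0 : ∀ k, 0 ≤ x k := by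
    intro k
    induction k with
    | zero => exact hx.ge
    | succ k ih => rw [hxc]; exact add_nonneg ih (hc k)
  -- The fractional part acts as a potential. A change with increment below `1` lowers it; an
  -- increment of at least `1` contributes `2` and raises it by less than `1`.
  suffices h : (numChanges (fun i => ⌊x i⌋₊) k : ℝ) ≤
      2 * ∑ i ∈ Finset.range k, min 1 (c i) - (x k - ⌊x k⌋₊) by
    have := Nat.floor_le (hx0 k)
    linarith
  induction k with
  | zero => simp [numChanges, hx]
  | succ k ih =>
    rw [numChanges, Finset.sum_range_succ]
    have h1 := Nat.floor_le (hx0 k)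
    have h2 := Nat.lt_floor_add_one (x k)
    have h3 := Nat.floor_le (hx0 (k + 1))
    have h4 := Nat.lt_floor_add_one (x (k + 1))
    have h5 := hxc k
    have h6 := hc k
    push_cast
    split_ifs with h
    · rw [h] at h4 ⊢
      rw [min_eq_right (by linarith)]
      linarith
    · have h7 : (⌊x k⌋₊ : ℝ) + 1 ≤ ⌊x (k + 1)⌋₊ := by
        have : ⌊x k⌋₊ ≤ ⌊x (k + 1)⌋₊ := Nat.floor_le_floor (by linarith)
        have : ⌊x k⌋₊ + 1 ≤ ⌊x (k + 1)⌋₊ := by omega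
        exact_mod_cast this
      rcases min_cases 1 (c k) with ⟨h8, h9⟩ | ⟨h8, h9⟩ <;> rw [h8] <;> linarith

theorem min_one_le_rpow {y r : ℝ} (hy : 0 ≤ y) (hr : 0 < r) (hr1 : r ≤ 1) : min 1 y ≤ y ^ r := by
  rcases le_total 1 y with h | h
  · rw [min_eq_left h]
    exact Real.one_le_rpow h hr.le
  · rw [min_eq_right h]
    exact Real.self_le_rpow_of_le_one hy h hr1

namespace LowerApprox

/-- The integer part of `2 ^ n * low n k`. -/
def lowFloor {U : List Bool →. List Bool} {Q D : ℝ} (a : LowerApprox U Q D) (n k : ℕ) : ℕ :=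
  a.V n k / 2 ^ (k + 1)

theorem lowFloor_eq {U : List Bool →. List Bool} {Q D : ℝ} (a : LowerApprox U Q D) (n k : ℕ) :
    a.lowFloor n k = ⌊2 ^ n * a.low n k⌋₊ := by
  unfold lowFloor low
  rw [← Nat.floor_div_eq_div (K := ℝ)]
  congr 1
  push_cast
  rw [show n + k + 1 = n + (k + 1) by ring, pow_add 2 n (k + 1)]
  field_simp

theorem computable_lowFloor {U : List Bool →. List Bool} {Q D : ℝ} (a : LowerApprox U Q D) :
    Computable₂ a.lowFloor :=
  Primrec.nat_div.to_comp.comp a.computable_V (primrec_pow.to_comp.comp (Computable.const 2)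
    (Computable.succ.comp Computable.snd))

theorem computable_numChanges {U : List Bool →. List Bool} {Q D : ℝ} (a : LowerApprox U Q D) :
    Computable₂ fun n k => numChanges (a.lowFloor n) k := by
  have h := Computable.nat_rec (α := ℕ × ℕ) (σ := ℕ) (f := fun p => p.2) (g := fun _ => 0)
    (h := fun p y => y.2 + cond (decide (a.lowFloor p.1 (y.1 + 1) = a.lowFloor p.1 y.1)) 0 1)
    Computable.snd (Computable.const 0) (by
      have h1 : Computable fun x : (ℕ × ℕ) × ℕ × ℕ => x.1.1 := Computable.fst.comp Computable.fst
      have h2 : Computable fun x : (ℕ × ℕ) × ℕ × ℕ => x.2.1 := Computable.fst.comp Computable.snd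
      refine Primrec.nat_add.to_comp.comp (Computable.snd.comp Computable.snd) ?_
      refine Computable.cond (computable_decide_eq
        (a.computable_lowFloor.comp h1 (Computable.succ.comp h2))
        (a.computable_lowFloor.comp h1 h2)) (Computable.const 0) (Computable.const 1))
  refine h.of_eq fun p => ?_
  obtain ⟨n, k⟩ := p
  induction k with
  | zero => rfl
  | succ k ih =>
    simp only at ih ⊢
    rw [numChanges, ← ih, Bool.cond_decide]

/-- An increment `c` contributes `min 1 (2 ^ n * c)`, at most the `r`-th power of `2 ^ n` times the
term; these powers sum to `2 ^ (n * r)` times a finite constant. -/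
theorem exists_numChanges_le {U : List Bool →. List Bool} {Q D r : ℝ} (a : LowerApprox U Q D)
    (hU : IsComputer U) (hD : 0 < D) (hDr : D < r) (hr1 : r ≤ 1) :
    ∃ K : ℝ, 0 ≤ K ∧ ∀ n k, (numChanges (a.lowFloor n) k : ℝ) ≤ K * (2 : ℝ) ^ (n * r) := by
  have hr : 0 < r := hD.trans hDr
  have hs := a.hasSum_elim (f := term (Q * r) (D / r))
    (summable_term hU (Q * r) (div_pos hD hr) ((div_lt_one hr).2 hDr)).hasSum
  have hseq : ∀ m, a.seq m ^ r = (a.e m).elim 0 fun x => term (Q * r) (D / r) x.1 := by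
    intro m
    unfold seq
    cases a.e m with
    | none => simp [hr.ne']
    | some x => exact weight_rpow _ _ _ _
  refine ⟨2 * ∑' p : Dom U, term (Q * r) (D / r) p.1,
    mul_nonneg two_pos.le (tsum_nonneg fun _ => term_nonneg _ _ _), fun n k => ?_⟩
  choose c hc0 hc1 _ hc2 using a.exists_low_succ n
  have h1 := numChanges_floor_le (x := fun k => 2 ^ n * a.low n k) (c := fun k => 2 ^ n * c k)
    (by simp [low_zero]) (fun k => mul_nonneg (by positivity) (hc0 k))
    (fun k => by simp only [hc2 k]; ring) k
  simp only [← lowFloor_eq] at h1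
  refine h1.trans ?_
  rw [mul_assoc]
  refine mul_le_mul_of_nonneg_left ?_ two_pos.le
  calc ∑ i ∈ Finset.range k, min 1 (2 ^ n * c i)
      ≤ ∑ i ∈ Finset.range k, a.seq i ^ r * (2 : ℝ) ^ (n * r) := by
        refine Finset.sum_le_sum fun i _ => ?_
        refine (min_le_min_left 1 (mul_le_mul_of_nonneg_left (hc1 i) (by positivity))).trans ?_
        refine (min_one_le_rpow (mul_nonneg (by positivity) (a.seq_nonneg i)) hr hr1).trans ?_
        rw [Real.mul_rpow (by positivity) (a.seq_nonneg i), ← Real.rpow_natCast,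
          ← Real.rpow_mul two_pos.le, mul_comm]
    _ = (∑ i ∈ Finset.range k, a.seq i ^ r) * (2 : ℝ) ^ (n * r) := by rw [Finset.sum_mul]
    _ ≤ _ := by
        refine mul_le_mul_of_nonneg_right ?_ (by positivity)
        simp only [hseq]
        refine sum_le_hasSum _ (fun i _ => ?_) hs
        rw [← hseq]
        exact Real.rpow_nonneg (a.seq_nonneg i) r

/-- Some stage carries the last value of `lowFloor n`; it determines `⌊2 ^ n * W⌋` up to `2`. -/
theorem exists_final_stage {U : List Bool →. List Bool} {Q D : ℝ} (a : LowerApprox U Q D)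
    (hU : IsComputer U) (hD : 0 < D) (hD1 : D < 1) {n B : ℕ}
    (hB : ∀ k, numChanges (a.lowFloor n) k ≤ B) :
    ∃ j ≤ B, (∃ k, numChanges (a.lowFloor n) k = j) ∧ ∃ b < 4, ∀ k,
      numChanges (a.lowFloor n) k = j → a.lowFloor n k + b = ⌊2 ^ n * W U Q D⌋₊ := by
  have hsum := a.hasSum_seq hU hD hD1
  have hW0 : 0 ≤ W U Q D := hsum.nonneg a.seq_nonneg
  obtain ⟨k₀, hk₀⟩ : ∃ k₀, ∀ k, numChanges (a.lowFloor n) k ≤ numChanges (a.lowFloor n) k₀ := by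
    have hbdd : BddAbove (Set.range (numChanges (a.lowFloor n))) :=
      ⟨B, by rintro _ ⟨k, rfl⟩; exact hB k⟩
    obtain ⟨k₀, hk₀⟩ := Nat.sSup_mem (Set.range_nonempty _) hbdd
    exact ⟨k₀, fun k => hk₀ ▸ le_csSup hbdd ⟨k, rfl⟩⟩
  have hconst : ∀ k, numChanges (a.lowFloor n) k = numChanges (a.lowFloor n) k₀ →
      a.lowFloor n k = a.lowFloor n k₀ := by
    intro k hk
    rcases le_total k k₀ with h | h
    · exact eq_of_numChanges_eq h hk
    · exact (eq_of_numChanges_eq h hk.symm).symm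
  have hlow0 : ∀ k, 0 ≤ a.low n k := fun k => by unfold low; positivity
  have h1 : a.lowFloor n k₀ ≤ ⌊2 ^ n * W U Q D⌋₊ := by
    rw [lowFloor_eq]
    exact Nat.floor_le_floor (mul_le_mul_of_nonneg_left (a.low_le_W hU hD hD1 n k₀) (by positivity))
  -- Approximation loses at most `2` and rounding less than `1`; the bound `4` lets the correction
  -- be read as a residue modulo `4`.
  have h2 : ⌊2 ^ n * W U Q D⌋₊ < a.lowFloor n k₀ + 4 := by
    have h3 : W U Q D - (1 / 2) ^ n < W U Q D := by
      have : (0 : ℝ) < (1 / 2) ^ n := by positivity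
      linarith
    obtain ⟨k, hk, hkk⟩ := ((hsum.tendsto_sum_nat.eventually (lt_mem_nhds h3)).and
      (eventually_ge_atTop k₀)).exists
    have h4 := a.sum_le_low_add n k
    have h5 : a.lowFloor n k = a.lowFloor n k₀ :=
      hconst k (le_antisymm (hk₀ k) (numChanges_mono _ hkk))
    have h6 := Nat.lt_floor_add_one (2 ^ n * a.low n k)
    rw [← lowFloor_eq, h5] at h6
    rw [Nat.floor_lt (by positivity)]
    calc 2 ^ n * W U Q D ≤ 2 ^ n * (a.low n k + 2 * (1 / 2) ^ n) := by
          refine mul_le_mul_of_nonneg_left (by linarith) (by positivity)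
      _ = 2 ^ n * a.low n k + 2 := by rw [one_div_pow]; field_simp
      _ < (a.lowFloor n k₀ + 4 : ℕ) := by push_cast; linarith
  exact ⟨_, hB k₀, ⟨k₀, rfl⟩, ⌊2 ^ n * W U Q D⌋₊ - a.lowFloor n k₀, by omega,
    fun k hk => by rw [hconst k hk]; omega⟩

/-- Find the first stage with `j` changes, where `4 * j + b` is given in binary, and correct the
value of `lowFloor n` at this stage by `b`. -/
def recover {U : List Bool →. List Bool} {Q D : ℝ} (a : LowerApprox U Q D) :
    ℕ × List Bool →. List Bool := fun p =>
  (Nat.rfind fun k => (Part.some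
    (decide (numChanges (a.lowFloor p.1) k = ofBinary p.2 / 4)) : Part Bool)).map fun k =>
      toBinary p.1 (a.lowFloor p.1 k + ofBinary p.2 % 4)

theorem partrec_recover {U : List Bool →. List Bool} {Q D : ℝ} (a : LowerApprox U Q D) :
    Partrec a.recover := by
  have hn : Computable fun p : (ℕ × List Bool) × ℕ => p.1.1 :=
    Computable.fst.comp Computable.fst
  have hs : Computable fun p : (ℕ × List Bool) × ℕ => ofBinary p.1.2 :=
    primrec_ofBinary.to_comp.comp (Computable.snd.comp Computable.fst)
  have h1 : Computable₂ fun (p : ℕ × List Bool) (k : ℕ) =>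
      decide (numChanges (a.lowFloor p.1) k = ofBinary p.2 / 4) :=
    computable_decide_eq (a.computable_numChanges.comp hn Computable.snd)
      (Primrec.nat_div.to_comp.comp hs (Computable.const 4))
  have h2 : Computable₂ fun (p : ℕ × List Bool) (k : ℕ) =>
      toBinary p.1 (a.lowFloor p.1 k + ofBinary p.2 % 4) :=
    primrec_toBinary.to_comp.comp hn (Primrec.nat_add.to_comp.comp
      (a.computable_lowFloor.comp hn Computable.snd)
      (Primrec.nat_mod.to_comp.comp hs (Computable.const 4)))
  exact (Partrec.rfind h1.partrec₂).map h2

theorem exists_H_le {U : List Bool →. List Bool} {Q D : ℝ} (a : LowerApprox U Q D)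
    (hU : IsOptimal U) (hD : 0 < D) {r : ℚ} (hDr : D < r) (hr1 : (r : ℝ) ≤ 1) (hD1 : D < 1) :
    ∃ K : ℝ, ∀ n : ℕ, (H U (pre (bits (W U Q D)) n) : ℝ) ≤ r * n + 2 * Real.sqrt n + K := by
  obtain ⟨K, hK0, hK⟩ := a.exists_numChanges_le hU.1 hD hDr hr1
  have hr0 : 0 ≤ r := by exact_mod_cast (hD.trans hDr).le
  have hr : (r : ℝ) = r.num.toNat / r.den := by
    have h1 : ((r.num.toNat : ℤ) : ℝ) = r.num := by
      rw [Int.toNat_of_nonneg (Rat.num_nonneg.2 hr0)]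
    rw [← Int.cast_natCast, h1]
    exact_mod_cast (Rat.num_div_den r).symm
  -- Since `2 ^ (n * r) ≤ 2 * 2 ^ ⌊n * r⌋`, the code `4 * j + b` is below `(8 * K + 4) * 2 ^ ⌊n *
  -- r⌋`. Rationality of `r` makes the block length computable.
  obtain ⟨c₀, hc₀⟩ := pow_unbounded_of_one_lt (8 * K + 4) (one_lt_two (α := ℝ))
  let ℓ : ℕ → ℕ := fun n => n * r.num.toNat / r.den + c₀
  have hℓ : Computable ℓ := Primrec.to_comp (Primrec.nat_add.comp (Primrec.nat_div.comp
    (Primrec.nat_mul.comp Primrec.id (Primrec.const _)) (Primrec.const _)) (Primrec.const _))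
  have hℓle : ∀ n : ℕ, (ℓ n : ℝ) ≤ r * n + c₀ := by
    intro n
    have := Nat.cast_div_le (α := ℝ) (m := n * r.num.toNat) (n := r.den)
    push_cast at this
    simp only [ℓ, Nat.cast_add]
    rw [hr, div_mul_eq_mul_div, mul_comm (r.num.toNat : ℝ)]
    linarith
  have hleℓ : ∀ n : ℕ, 4 * (K * (2 : ℝ) ^ (n * (r : ℝ))) + 4 < 2 ^ ℓ n := by
    intro n
    have h1 : n * (r : ℝ) ≤ ((n * r.num.toNat / r.den + 1 : ℕ) : ℝ) := by
      have := Nat.lt_floor_add_one ((n * r.num.toNat : ℕ) / (r.den : ℝ))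
      rw [Nat.floor_div_eq_div] at this
      rw [hr, ← mul_div_assoc]
      push_cast at this ⊢
      exact this.le
    have h2 := Real.rpow_le_rpow_of_exponent_le one_le_two h1
    rw [Real.rpow_natCast, pow_succ] at h2
    have h3 : (1 : ℝ) ≤ 2 ^ (n * r.num.toNat / r.den) := one_le_pow₀ one_le_two
    simp only [ℓ, pow_add]
    nlinarith [mul_le_mul_of_nonneg_left h2 hK0]
  obtain ⟨c, hc⟩ := hU.exists_program_block hℓ a.partrec_recover
  refine ⟨2 + c₀ + c, fun n => ?_⟩
  have hW0 : 0 ≤ W U Q D := (a.hasSum_seq hU.1 hD hD1).nonneg a.seq_nonneg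
  obtain ⟨j, hj, ⟨k, hk⟩, b, hb, hjb⟩ := a.exists_final_stage hU.1 hD hD1 (n := n)
    (B := ⌊K * (2 : ℝ) ^ (n * (r : ℝ))⌋₊) (fun k => Nat.le_floor (hK n k))
  have hlt : 4 * j + b < 2 ^ ℓ n := by
    have h1 : (j : ℝ) ≤ K * (2 : ℝ) ^ (n * (r : ℝ)) :=
      (Nat.le_floor_iff (by positivity)).1 hj
    have h2 : (b : ℝ) < 4 := by exact_mod_cast hb
    have h3 : ((4 * j + b : ℕ) : ℝ) < ((2 ^ ℓ n : ℕ) : ℝ) := by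
      push_cast
      linarith [hleℓ n]
    exact_mod_cast h3
  have hval : ofBinary (toBinary (ℓ n) (4 * j + b)) = 4 * j + b := by
    rw [ofBinary_toBinary, Nat.mod_eq_of_lt hlt]
  have hmem : pre (bits (W U Q D)) n ∈ a.recover (n, toBinary (ℓ n) (4 * j + b)) := by
    simp only [recover, hval, show (4 * j + b) / 4 = j by omega, show (4 * j + b) % 4 = b by omega]
    -- The search may stop at a stage other than `k`, but every stage with `j` changes carries the
    -- same value.
    obtain ⟨k', hk', -⟩ := Nat.rfind_min'
      (p := fun k => decide (numChanges (a.lowFloor n) k = j)) (m := k) (by simpa using hk)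
    have hspec : numChanges (a.lowFloor n) k' = j := by simpa using Nat.rfind_spec hk'
    rw [pre_bits hW0, ← hjb k' hspec]
    exact Part.mem_map (fun k => toBinary n (a.lowFloor n k + b)) hk'
  obtain ⟨p, hp, hpl⟩ := hc n _ _ (length_toBinary _ _) hmem
  have h1 : ((H U (pre (bits (W U Q D)) n) : ℕ) : ℝ) ≤ 2 * n.sqrt + 2 + ℓ n + c := by
    exact_mod_cast (H_le hp).trans (hpl.trans (by have := length_header_le n; omega))
  have h2 := Real.nat_sqrt_le_real_sqrt (a := n)
  linarith [hℓle n]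

theorem compressible {U : List Bool →. List Bool} {Q D : ℝ} (a : LowerApprox U Q D)
    (hU : IsOptimal U) (hD : 0 < D) (hD1 : D < 1) : Compressible U D (bits (W U Q D)) := by
  refine ⟨fun n => max 0 ((H U (pre (bits (W U Q D)) n) : ℝ) - D * n), ?_, fun n _ => ?_⟩
  · rw [isLittleO_iff]
    intro ε hε
    -- Half of `ε * n` pays for `r - D`, a quarter for `2 * √n` and a quarter for `K`.
    obtain ⟨r, hDr, hr⟩ := exists_rat_btwn (show D < min 1 (D + ε / 2) from
      lt_min hD1 (by linarith))
    obtain ⟨hr1, hr2⟩ := lt_min_iff.1 hr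
    obtain ⟨K, hK⟩ := a.exists_H_le hU hD hDr hr1.le hD1
    have hsq : Tendsto (fun n : ℕ => Real.sqrt n) atTop atTop :=
      Real.tendsto_sqrt_atTop.comp tendsto_natCast_atTop_atTop
    filter_upwards [hsq.eventually_ge_atTop (8 / ε), hsq.eventually_ge_atTop 1,
      tendsto_natCast_atTop_atTop.eventually_ge_atTop (4 * K / ε)] with n h1 h2 h3
    have hn : (0 : ℝ) ≤ n := Nat.cast_nonneg n
    have hsn := Real.mul_self_sqrt hn
    rw [Real.norm_of_nonneg (le_max_left _ _), Real.norm_of_nonneg hn]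
    refine max_le (by positivity) ?_
    rw [div_le_iff₀ hε] at h1 h3
    have h4 : 8 * Real.sqrt n ≤ ε * n := by nlinarith
    have h5 : ((r : ℝ) - D) * n ≤ ε / 2 * n := mul_le_mul_of_nonneg_right (by linarith) hn
    nlinarith [hK n]
  · have := le_max_right 0 ((H U (pre (bits (W U Q D)) n) : ℝ) - D * n)
    linarith

end LowerApprox

/-! ### Divergence -/

theorem card_le_of_length_le {S : Finset (List Bool)}
    (hS : ∀ p ∈ S, ∀ q ∈ S, p <+: q → p = q) {L : ℕ} (hL : ∀ p ∈ S, p.length ≤ L) :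
    S.card ≤ 2 ^ L := by
  have h1 : ∑ _p ∈ S, (1 / 2 : ℝ) ^ L ≤ 1 :=
    (Finset.sum_le_sum fun p hp => pow_le_pow_of_le_one (by norm_num) (by norm_num) (hL p hp)).trans
      (sum_half_pow_length_le_one hS)
  rw [Finset.sum_const, nsmul_eq_mul, one_div_pow, mul_one_div, div_le_one (by positivity)] at h1
  exact_mod_cast h1

/-- For `D ≥ 1` the exponential factor is at least `2 ^ (-ℓ)`, so the case `D = 1` governs
divergence. -/
theorem le_weight {Q D : ℝ} (hQ : 0 < Q) (hD1 : 1 ≤ D) {l m ℓ : ℕ} (h1 : l ≤ ℓ) (h2 : ℓ ≤ m) :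
    (l : ℝ) ^ Q / 2 ^ m ≤ weight Q D ℓ := by
  unfold weight
  rw [div_eq_mul_inv]
  refine mul_le_mul (Real.rpow_le_rpow (by positivity) (by exact_mod_cast h1) hQ.le) ?_
    (by positivity) (by positivity)
  rw [← Real.rpow_natCast, ← Real.rpow_neg two_pos.le]
  refine Real.rpow_le_rpow_of_exponent_le one_le_two ?_
  rw [neg_div]
  refine neg_le_neg ((div_le_self (by positivity) hD1).trans (by exact_mod_cast h2))

theorem tendsto_sum_term {U : List Bool →. List Bool} (hU : IsOptimal U) {Q D : ℝ} (hQ : 0 < Q)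
    (hD1 : 1 ≤ D) :
    Tendsto (fun F : Finset (Dom U) => ∑ p ∈ F, term Q D p.1) atTop atTop := by
  classical
  obtain ⟨r, hr⟩ := exists_nat_gt (1 / Q)
  rw [div_lt_iff₀ hQ] at hr
  -- As `r * Q > 1`, `(g n) ^ Q` pays for the header and leaves a factor `2 ^ n`.
  let g : ℕ → ℕ := fun n => 2 ^ (r * ((header n).length + n))
  have hg : Computable g := Primrec.to_comp (primrec_pow.comp (Primrec.const 2)
    (Primrec.nat_mul.comp (Primrec.const r) (Primrec.nat_add.comp
      (Primrec.list_length.comp primrec_header) Primrec.id)))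
  have hg2 : Computable fun n => g n + 2 := Computable.succ.comp (Computable.succ.comp hg)
  obtain ⟨c, hc⟩ := hU.exists_program_block hg2 (F := fun p => Part.some p.2)
    (Computable.partrec Computable.snd)
  have hlarge : ∀ n : ℕ, ∃ F : Finset (Dom U), (2 : ℝ) ^ n / 2 ^ (c + 1) ≤
      ∑ p ∈ F, term Q D p.1 := by
    intro n
    choose P hP hPl using fun v : ℕ => hc n (toBinary (g n + 2) v) _ (length_toBinary _ _)
      (Part.mem_some _)
    have hinj : Set.InjOn (fun v => (⟨P v, Part.dom_iff_mem.2 ⟨_, hP v⟩⟩ : Dom U))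
        (Finset.range (2 ^ (g n + 2))) := by
      intro v hv w hw h
      refine toBinary_injOn (g n + 2) (by simpa using hv) (by simpa using hw) ?_
      have h1 : P v = P w := congrArg Subtype.val h
      have h2 := hP v
      rw [h1] at h2
      exact Part.mem_unique h2 (hP w)
    set S := (Finset.range (2 ^ (g n + 2))).image
      (fun v => (⟨P v, Part.dom_iff_mem.2 ⟨_, hP v⟩⟩ : Dom U)) with hS
    have hScard : S.card = 2 ^ (g n + 2) := by
      rw [hS, Finset.card_image_of_injOn hinj, Finset.card_range]
    have hshort : (S.filter fun p => p.1.length ≤ g n).card ≤ 2 ^ g n := by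
      rw [← Finset.card_map (Function.Embedding.subtype _)]
      refine card_le_of_length_le ?_ ?_
      · intro p hp q hq h
        simp only [Finset.mem_map, Function.Embedding.subtype_apply] at hp hq
        obtain ⟨p, -, rfl⟩ := hp
        obtain ⟨q, -, rfl⟩ := hq
        exact hU.1.2 _ _ p.2 q.2 h
      · intro p hp
        simp only [Finset.mem_map, Function.Embedding.subtype_apply, Finset.mem_filter] at hp
        obtain ⟨p, ⟨-, hp⟩, rfl⟩ := hp
        exact hp
    -- At most `2 ^ g n` of the `2 ^ (g n + 2)` programs are short, by Kraft.
    have hlong : 2 ^ (g n + 1) ≤ (S.filter fun p => ¬ p.1.length ≤ g n).card := by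
      have := Finset.card_filter_add_card_filter_not (s := S) (fun p => p.1.length ≤ g n)
      rw [hScard] at this
      rw [pow_succ] at this ⊢
      rw [pow_succ] at this
      omega
    refine ⟨S.filter fun p => ¬ p.1.length ≤ g n, ?_⟩
    have hgQ : (2 : ℝ) ^ ((header n).length + n) ≤ (g n : ℝ) ^ Q := by
      simp only [g]
      push_cast
      rw [← Real.rpow_natCast, ← Real.rpow_natCast, ← Real.rpow_mul two_pos.le]
      refine Real.rpow_le_rpow_of_exponent_le one_le_two ?_
      push_cast
      have : (0 : ℝ) ≤ ((header n).length : ℝ) + n := by positivity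
      nlinarith
    have hterm : ∀ p ∈ S.filter fun p => ¬ p.1.length ≤ g n,
        (g n : ℝ) ^ Q / 2 ^ ((header n).length + (g n + 2) + c) ≤ term Q D p.1 := by
      intro p hp
      simp only [Finset.mem_filter, hS, Finset.mem_image] at hp
      obtain ⟨⟨v, -, rfl⟩, hp⟩ := hp
      exact le_weight hQ hD1 (not_le.1 hp).le (hPl v)
    calc (2 : ℝ) ^ n / 2 ^ (c + 1) = 2 ^ (g n + 1) *
          (2 ^ ((header n).length + n) / 2 ^ ((header n).length + (g n + 2) + c)) := by
          field_simp
          ring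
      _ ≤ (S.filter fun p => ¬ p.1.length ≤ g n).card *
          ((g n : ℝ) ^ Q / 2 ^ ((header n).length + (g n + 2) + c)) := by
          refine mul_le_mul (by exact_mod_cast hlong) ?_ (by positivity) (by positivity)
          gcongr
      _ = ∑ _p ∈ S.filter fun p => ¬ p.1.length ≤ g n,
          (g n : ℝ) ^ Q / 2 ^ ((header n).length + (g n + 2) + c) := by
          rw [Finset.sum_const, nsmul_eq_mul]
      _ ≤ _ := Finset.sum_le_sum hterm
  have hmono : Monotone fun F : Finset (Dom U) => ∑ p ∈ F, term Q D p.1 :=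
    fun F G h => Finset.sum_le_sum_of_subset_of_nonneg h fun _ _ _ => term_nonneg _ _ _
  refine tendsto_atTop_atTop_of_monotone hmono fun b => ?_
  obtain ⟨n, hn⟩ := pow_unbounded_of_one_lt (b * 2 ^ (c + 1)) (one_lt_two (α := ℝ))
  obtain ⟨F, hF⟩ := hlarge n
  exact ⟨F, le_trans ((le_div_iff₀ (by positivity)).2 hn.le) hF⟩

end AIT

theorem theorem3p1 (U : List Bool →. List Bool) (hU : AIT.IsOptimal U)
    (Q D : ℝ) (hQ : 0 < Q) (hD : 0 < D) :
    (AIT.ComputableReal Q → AIT.ComputableReal D → D < 1 →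
      Summable (fun p : AIT.Dom U => AIT.term Q D p.1) ∧
      AIT.LeftComputable (AIT.W U Q D) ∧
      AIT.ChaitinRandom U D (AIT.bits (AIT.W U Q D)) ∧
      AIT.Compressible U D (AIT.bits (AIT.W U Q D))) ∧
    (1 ≤ D →
      Tendsto (fun F : Finset (AIT.Dom U) => ∑ p ∈ F, AIT.term Q D p.1) atTop atTop) := by
  refine ⟨fun hQc hDc hD1 => ?_, fun hD1 => AIT.tendsto_sum_term hU hQ hD1⟩
  obtain ⟨a⟩ := AIT.exists_lowerApprox hU.1.1 hQ hD hQc hDc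
  exact ⟨AIT.summable_term hU.1 Q hD hD1, a.leftComputable_W hU.1 hD hD1,
    a.chaitinRandom hU hQ hD hD1, a.compressible hU hD hD1⟩
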